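/- **Definitions.** A *simple mixed graph* $G=(V_G,E_G,\vec E_G)$ consists of a finite set $V_G$ of $n$ vertices, a set $E_G$ of edges (unordered pairs of distinct vertices) and a set $\vec E_G$ of arcs (ordered pairs of distinct vertices). The undirected part $G_u$ is the graph $(V_G,E_G)$. A *submixed graph* of $G$ is given by subsets of $V_G,E_G,\vec E_G$ such that the ends of the chosen edges and arcs are chosen. The *integrated adjacency matrix* is the $2n\times 2n$ matrix $$\mathcal I(G)=\begin{bmatrix}A&B\\B^T&A\end{bmatrix},$$ where $A$ is the adjacency matrix of $G_u$, and $B_{uv}=1$ if $(u,v)\in\vec E_G$ and $B_{uv}=0$ otherwise. A *walk* is a sequence $v_0,e_1,v_1,\dots,e_k,v_k$ with each $e_j$ equal to the edge $\{v_{j-1},v_j\}$, the arc $(v_{j-1},v_j)$ (traversed forward) or the arc $(v_j,v_{j-1})$ (traversed in reverse). In a mixed graph with at least one arc, a walk is *alternating* if its successive arcs are traversed alternately forward and in reverse. An alternating walk satisfies the *link condition* if each edge occurs in it at most twice, with an odd number of arcs between the two occurrences if it occurs twice, and no arc occurs more than once. It is an *alternating path* if it satisfies the link condition and each vertex occurs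 at most twice, with an odd number of arcs between the two occurrences if it occurs twice. It is an *alternating cycle* if it satisfies the link condition and $v_0=v_k$. A submixed graph $G'$ with at least one arc is *special* if (i) any two distinct vertices of $G'$ are joined by an alternating walk in $G'$, and (ii) whenever a component $K$ of $G'_u$ has a vertex with an in-arc in $G'$ and a vertex with an out-arc in $G'$, each vertex $v$ of $K$ has a closed alternating walk in $G'$ from $v$ to $v$ with an odd number of arcs (counted with repetition). A *mixed component* of $G$ is a component of $G_u$ all of whose vertices have out-degree $0$ in $G$ (Type I), or a component of $G_u$ all of whose vertices have in-degree $0$ in $G$ (Type II), or a maximal special submixed graph of $G$ (Type III). Mixed components form a multiset: one that is both of Type I and of Type II is counted twice. For a mixed component $H$, let $\Theta_H$ (resp. $\Omega_H$) be the set of vertices (resp. edges) of $H$ that some alternating path in $H$ contains twice, and let $t(H)=|E_H|+|\Omega_H|+|\vec E_H|$. $H$ has the *AP property* if it is an (undirected) path on at least one vertex, or if it has an alternating path containing each vertex of $\Theta_H$ exactly twice and each other vertex exactly once, all arcs, and each edge of $\Omega_H$ exactly twice and each other edge exactly once. $H$ has the *AC property* if it is an (undirected) cycle on at least three vertices, or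 if it has an alternating cycle with an even number of arcs, starting at a vertex $u$, which contains $u$ three times if $u\in\Theta_H$ and twice otherwise, each vertex $v\ne u$ exactly twice if $v\in\Theta_H$ and exactly once otherwise, all arcs, and each edge of $\Omega_H$ exactly twice and each other edge exactly once. **Theorem.** Let $G$ be a simple mixed graph on $n$ vertices in which each mixed component has the AP property or the AC property. Let $F_1,\dots,F_q$ be the mixed components of $G$ with the AP property, let $H_1,\dots,H_l$ be the mixed components $H$ of $G$ with the AC property for which $t(H)$ is even, and let $p(G)$ be the number of mixed components of $G$ with the AC property (all listed and counted with multiplicity). If $t(F_i)$ is odd for all $i=1,\dots,q$, then $$\det\mathcal I(G)=2^{p(G)}(-1)^{2n-p(G)-\sum_{i=1}^{q}\frac{t(F_i)+1}{2}}\sum_{S\subseteq\{1,\dots,l\}}(-1)^{|S|-\sum_{i\in S}\frac{t(H_i)}{2}},$$ and otherwise $\det\mathcal I(G)=0$. -/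

import Mathlib

/-- A simple mixed graph with vertex set `V`: a loopless set of undirected edges without multiple
edges (the undirected part `G_u`), and a set of arcs without directed loops or multiple arcs. An
edge `{u, v}` and the arcs `(u, v)`, `(v, u)` may all be present at the same time. -/
structure SimpleMixedGraph (V : Type*) where
  /-- the undirected part `G_u` -/
  und : SimpleGraph V
  /-- `Arc u v` means that `u → v` -/
  Arc : V → V → Prop
  arc_irrefl : ∀ v, ¬ Arc v v

namespace SimpleMixedGraph

variable {V : Type*}

/-- The adjacency matrix of the directed part of `G`. -/
noncomputable def arcMatrix (G : SimpleMixedGraph V) : Matrix V V ℝ :=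
  open Classical in Matrix.of fun u v => if G.Arc u v then 1 else 0

/-- The integrated adjacency matrix `𝓘(G)`. The index `Sum.inl v` is the first copy `v'` of `v`,
and `Sum.inr v` is the second copy `v''`. -/
noncomputable def integratedAdjMatrix (G : SimpleMixedGraph V) : Matrix (V ⊕ V) (V ⊕ V) ℝ :=
  open Classical in
  Matrix.fromBlocks (G.und.adjMatrix ℝ) G.arcMatrix G.arcMatrix.transpose (G.und.adjMatrix ℝ)

/-- A submixed graph of `G`: a subgraph of the undirected part (its vertices and edges), together
with a set of arcs of `G` whose ends are among these vertices. -/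
structure SubmixedGraph (G : SimpleMixedGraph V) extends G.und.Subgraph where
  Arc : V → V → Prop
  arc_sub : ∀ {u v : V}, Arc u v → G.Arc u v
  arc_fst_mem : ∀ {u v : V}, Arc u v → u ∈ verts
  arc_snd_mem : ∀ {u v : V}, Arc u v → v ∈ verts

/-- The three ways in which a step of a walk is made: along an edge, along an arc in its forward
direction, or along an arc in its reverse direction. -/
inductive StepKind : Type
  | edge : StepKind
  | forward : StepKind
  | reverse : StepKind

namespace SubmixedGraph

variable {G : SimpleMixedGraph V}

/-- The submixed graph order: inclusion of vertices, edges and arcs. -/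
instance : LE (SubmixedGraph G) where
  le H K := H.toSubgraph ≤ K.toSubgraph ∧ ∀ u v, H.Arc u v → K.Arc u v

/-- The arc set. -/
def arcSet (H : SubmixedGraph G) : Set (V × V) := {a | H.Arc a.1 a.2}

/-- A walk `v₀, e₀, v₁, e₁, …, e_{k-1}, v_k` of length `k` in `H`. The values of `vert` after `k`
and of `kind` from `k` on are irrelevant. -/
structure Walk (H : SubmixedGraph G) where
  length : ℕ
  vert : ℕ → V
  kind : ℕ → StepKind
  vert_mem : ∀ i ≤ length, vert i ∈ H.verts
  edge_step : ∀ i < length, kind i = StepKind.edge → H.Adj (vert i) (vert (i + 1))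
  forward_step : ∀ i < length, kind i = StepKind.forward → H.Arc (vert i) (vert (i + 1))
  reverse_step : ∀ i < length, kind i = StepKind.reverse → H.Arc (vert (i + 1)) (vert i)

namespace Walk

variable {H : SubmixedGraph G}

/-- The edge (an unordered pair) or the arc (an ordered pair) used in the `i`-th step. -/
def link (W : H.Walk) (i : ℕ) : Sym2 V ⊕ V × V :=
  match W.kind i with
  | StepKind.edge => Sum.inl s(W.vert i, W.vert (i + 1))
  | StepKind.forward => Sum.inr (W.vert i, W.vert (i + 1))
  | StepKind.reverse => Sum.inr (W.vert (i + 1), W.vert i)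

/-- The number of occurrences of the vertex `v` in the walk. -/
noncomputable def vertCount (W : H.Walk) (v : V) : ℕ :=
  {i : ℕ | i ≤ W.length ∧ W.vert i = v}.ncard

/-- The number of occurrences of the edge `e` in the walk. -/
noncomputable def edgeCount (W : H.Walk) (e : Sym2 V) : ℕ :=
  {i : ℕ | i < W.length ∧ W.link i = Sum.inl e}.ncard

/-- The number of occurrences of the arc `a` in the walk, in either direction. -/
noncomputable def arcCount (W : H.Walk) (a : V × V) : ℕ :=
  {i : ℕ | i < W.length ∧ W.link i = Sum.inr a}.ncard

/-- The number of arcs (with repetitions) among the steps `i, i + 1, …, j - 1`, that is, between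
the positions `i` and `j` of the vertex sequence. -/
noncomputable def arcsBetween (W : H.Walk) (i j : ℕ) : ℕ :=
  {m : ℕ | i ≤ m ∧ m < j ∧ W.kind m ≠ StepKind.edge}.ncard

/-- The total number of arcs (with repetitions) in the walk. -/
noncomputable def numArcs (W : H.Walk) : ℕ := W.arcsBetween 0 W.length

/-- Alternating walks, in a mixed graph with at least one arc: any two successive arcs of the walk
(there may be edges between them) are traversed in opposite directions. -/
def IsAlternating (W : H.Walk) : Prop :=
  H.arcSet.Nonempty ∧
  ∀ i j, i < j → j < W.length → W.kind i ≠ StepKind.edge → W.kind j ≠ StepKind.edge →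
    (∀ m, i < m → m < j → W.kind m = StepKind.edge) → W.kind i ≠ W.kind j

/-- The requirements on repeated edges and arcs shared by alternating paths and cycles: an edge
occurs at most twice, with an odd number of arcs between two occurrences, and no arc is
repeated. -/
def LinkCondition (W : H.Walk) : Prop :=
  (∀ e, W.edgeCount e ≤ 2) ∧
  (∀ i j e, i < j → j < W.length → W.link i = Sum.inl e → W.link j = Sum.inl e →
    Odd (W.arcsBetween (i + 1) j)) ∧
  (∀ a, W.arcCount a ≤ 1)

/-- Alternating paths. -/
def IsAlternatingPath (W : H.Walk) : Prop :=
  W.IsAlternating ∧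
  (∀ v, W.vertCount v ≤ 2) ∧
  (∀ i j, i < j → j ≤ W.length → W.vert i = W.vert j → Odd (W.arcsBetween i j)) ∧
  W.LinkCondition

/-- Alternating cycles. -/
def IsAlternatingCycle (W : H.Walk) : Prop :=
  W.IsAlternating ∧ W.vert 0 = W.vert W.length ∧ W.LinkCondition

end Walk

/-- Special submixed graphs. The connected components `c` are those of the undirected part of
`H`. -/
def IsSpecial (H : SubmixedGraph G) : Prop :=
  H.arcSet.Nonempty ∧
  (∀ u ∈ H.verts, ∀ v ∈ H.verts, u ≠ v →
    ∃ W : H.Walk, W.IsAlternating ∧ W.vert 0 = u ∧ W.vert W.length = v) ∧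
  (∀ c : H.toSubgraph.coe.ConnectedComponent,
    (∃ x ∈ c.supp, ∃ u, H.Arc u x) → (∃ y ∈ c.supp, ∃ u, H.Arc y u) →
    ∀ v ∈ c.supp, ∃ W : H.Walk, W.IsAlternating ∧ W.vert 0 = v ∧ W.vert W.length = v ∧
      Odd W.numArcs)

/-- `H` is a connected component of the undirected part `G_u` of `G`. -/
def IsUndComponent (H : SubmixedGraph G) : Prop :=
  H.arcSet = ∅ ∧
  ∃ c : G.und.ConnectedComponent, H.toSubgraph = (⊤ : G.und.Subgraph).induce c.supp

/-- `H` is a path (an undirected path graph on at least one vertex, without arcs). -/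
def IsPath (H : SubmixedGraph G) : Prop :=
  H.arcSet = ∅ ∧ ∃ m : ℕ, Nonempty (H.toSubgraph.coe ≃g SimpleGraph.pathGraph (m + 1))

/-- `H` is a cycle (an undirected cycle graph on at least three vertices, without arcs). -/
def IsCycle (H : SubmixedGraph G) : Prop :=
  H.arcSet = ∅ ∧ ∃ m : ℕ, 3 ≤ m ∧ Nonempty (H.toSubgraph.coe ≃g SimpleGraph.cycleGraph m)

/-- `Θ_H`: the vertices that some alternating path in `H` contains twice. -/
def Theta (H : SubmixedGraph G) : Set V :=
  {v | v ∈ H.verts ∧ ∃ W : H.Walk, W.IsAlternatingPath ∧ W.vertCount v = 2}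

/-- `Ω_H`: the edges that some alternating path in `H` contains twice. -/
def Omega (H : SubmixedGraph G) : Set (Sym2 V) :=
  {e | e ∈ H.edgeSet ∧ ∃ W : H.Walk, W.IsAlternatingPath ∧ W.edgeCount e = 2}

/-- `t(H) = |E_H| + |Ω_H| + |A_H|`, where `A_H` is the arc set. -/
noncomputable def t (H : SubmixedGraph G) : ℕ :=
  H.edgeSet.ncard + H.Omega.ncard + H.arcSet.ncard

open Classical in
/-- The associated path property. -/
def AP (H : SubmixedGraph G) : Prop :=
  H.IsPath ∨
  ∃ W : H.Walk, W.IsAlternatingPath ∧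
    (∀ v ∈ H.verts, W.vertCount v = if v ∈ H.Theta then 2 else 1) ∧
    (∀ a ∈ H.arcSet, W.arcCount a = 1) ∧
    (∀ e ∈ H.edgeSet, W.edgeCount e = if e ∈ H.Omega then 2 else 1)

open Classical in
/-- The associated cycle property. -/
def AC (H : SubmixedGraph G) : Prop :=
  H.IsCycle ∨
  ∃ W : H.Walk, W.IsAlternatingCycle ∧ Even W.numArcs ∧
    (W.vertCount (W.vert 0) = if W.vert 0 ∈ H.Theta then 3 else 2) ∧
    (∀ v ∈ H.verts, v ≠ W.vert 0 → W.vertCount v = if v ∈ H.Theta then 2 else 1) ∧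
    (∀ a ∈ H.arcSet, W.arcCount a = 1) ∧
    (∀ e ∈ H.edgeSet, W.edgeCount e = if e ∈ H.Omega then 2 else 1)

end SubmixedGraph

/-- The three types of mixed components. -/
inductive ComponentType : Type
  | I : ComponentType
  | II : ComponentType
  | III : ComponentType

/-- `H` is a mixed component of `G` of the given type. -/
def IsMixedComponent (G : SimpleMixedGraph V) (τ : ComponentType) (H : SubmixedGraph G) : Prop :=
  match τ with
  | ComponentType.I => H.IsUndComponent ∧ ∀ v ∈ H.verts, ∀ u, ¬ G.Arc v u
  | ComponentType.II => H.IsUndComponent ∧ ∀ v ∈ H.verts, ∀ u, ¬ G.Arc u v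
  | ComponentType.III => Maximal SubmixedGraph.IsSpecial H

/-- The multiset of all mixed components of `G`, as the type of its members: a mixed component is
listed once for every type that it has. So a connected component of `G` without arcs, which is both
of Type I and of Type II, is listed twice, and every other mixed component once. -/
structure MixedComponent (G : SimpleMixedGraph V) where
  type : ComponentType
  graph : SubmixedGraph G
  isMixedComponent : G.IsMixedComponent type graph

/-- The mixed components of a finite mixed graph can be counted and enumerated. -/
instance (G : SimpleMixedGraph V) [Finite V] : Finite G.MixedComponent := by
  have h : Function.Injective fun C : G.MixedComponent =>
      ((ComponentType.casesOn C.type 0 1 2 : Fin 3), C.graph.verts, C.graph.Adj, C.graph.Arc) := by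
    rintro ⟨τ, ⟨⟨a, b, _, _, _⟩, c, _, _, _⟩, _⟩ ⟨τ', ⟨⟨a', b', _, _, _⟩, c', _, _, _⟩, _⟩ h
    simp only [Prod.mk.injEq] at h
    obtain ⟨h1, rfl, rfl, rfl⟩ := h
    cases τ <;> cases τ' <;> simp_all
  exact Finite.of_injective _ h

/-- `p(G)`: the number of mixed components of `G` with the AC property. -/
noncomputable def numAC (G : SimpleMixedGraph V) : ℕ :=
  Nat.card {C : G.MixedComponent // C.graph.AC}

end SimpleMixedGraph

/-! The matrix `𝓘(G)` is the adjacency matrix of an ordinary graph, `associatedGraph`: two copies of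
`G_u`, with each arc u → v turned into an edge from u in the first copy (`false`) to v in the second
(`true`). Its determinant is therefore the product of the determinants of the connected components
(`det_integratedAdjMatrix_eq_prod`).

A forward arc leads from the first copy to the second and a reverse arc leads back. So alternating
walks are the walks that lift to the associated graph, and the parity of the number of arcs tells
whether the copy has changed (`IsLift.odd_arcsBetween_iff`). The definitions translate accordingly.
An alternating path is a walk whose lift repeats no vertex, and the link condition forbids repeating
a lifted edge. The mixed components are the projections of the connected components
(`exists_equiv_connectedComponent`); those of Types I and II come from components inside one copy,
which explains why some are counted twice. In Type III, Θ and Ω consist of the vertices and edges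
with both lifts in the component. Hence a walk as in the AP or AC property has a lift that runs
exactly once through everything in the component, so the component is a path or a cycle with t edges
(`AP.exists_equiv`, `AC.exists_equiv`).

A path with t edges has determinant 0 for even t and (-1)^((t+1)/2) for odd t. A cycle has
determinant 2 for odd t and -2(1 + (-1)^(1-t/2)) for even t. There are 2n vertices in all, so giving
each component the sign (-1)^(number of its vertices) changes nothing, and it makes every cycle
contribute -2 times `cycleFactor`. Expanding the product of the factors 1 + (-1)^(1-t/2) yields the
sum over S. -/

/-! ### Determinants of paths and cycles. -/

/-- The adjacency matrix of the path `0, 1, …, N - 1`, to which an edge of weight `w` between its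
ends `0` and `N - 1` is added. -/
noncomputable def weightedCycleMatrix (N : ℕ) (w : ℝ) : Matrix (Fin N) (Fin N) ℝ :=
  Matrix.of fun i j =>
    (if i.val + 1 = j.val ∨ j.val + 1 = i.val then 1 else 0) +
      w * ((if i.val = 0 ∧ j.val + 1 = N then 1 else 0) +
        (if j.val = 0 ∧ i.val + 1 = N then 1 else 0))

/-- Contracting two adjacent vertices of degree two (a Schur complement). -/
theorem det_weightedCycleMatrix_two_add (N : ℕ) (hN : 1 ≤ N) (w : ℝ) :
    (weightedCycleMatrix (2 + N) w).det = -(weightedCycleMatrix N (-w)).det := by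
  -- The contracted vertices are 0 and 1: vertex 0 meets the rest only through the edge of weight w
  -- to the last vertex, vertex 1 only through the path edge to vertex 2. The rest is a bare path,
  -- of weight 0.
  set B : Matrix (Fin 2) (Fin N) ℝ := Matrix.of fun i j =>
    if i = 0 then (if j.val + 1 = N then w else 0) else (if j.val = 0 then 1 else 0) with hB
  set A : Matrix (Fin 2) (Fin 2) ℝ := !![0, 1; 1, 0] with hA
  have hAA : A * A = 1 := by
    ext i j; fin_cases i <;> fin_cases j <;> simp [hA]
  let _ : Invertible A := ⟨A, hAA, hAA⟩
  have h1 : (weightedCycleMatrix (2 + N) w).submatrix finSumFinEquiv finSumFinEquiv =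
      Matrix.fromBlocks A B B.transpose (weightedCycleMatrix N 0) := by
    ext i j
    rcases i with i | i <;> rcases j with j | j <;>
      simp only [weightedCycleMatrix, hA, hB, Matrix.submatrix_apply, Matrix.of_apply,
        Matrix.fromBlocks_apply₁₁, Matrix.fromBlocks_apply₁₂, Matrix.fromBlocks_apply₂₁,
        Matrix.fromBlocks_apply₂₂, Matrix.transpose_apply, finSumFinEquiv_apply_left,
        finSumFinEquiv_apply_right, Fin.val_castAdd, Fin.val_natAdd]
    · have h3 : 2 + N ≠ 1 := by omega
      fin_cases i <;> fin_cases j <;> simp <;> omega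
    · fin_cases i
      · split_ifs <;> first | (exfalso; omega) | (simp_all <;> omega)
      · split_ifs <;> first | (exfalso; omega) | simp_all
    · fin_cases j
      · split_ifs <;> first | (exfalso; omega) | (simp_all <;> omega)
      · split_ifs <;> first | (exfalso; omega) | simp_all
    · split_ifs <;> first | (exfalso; omega) | simp_all
  -- As `A` swaps the two contracted vertices, the correction pairs the w at the last remaining
  -- vertex with the 1 at the first: it is an edge of weight w between the new ends, and it is
  -- subtracted.
  have h2 : weightedCycleMatrix N 0 - B.transpose * ⅟A * B = weightedCycleMatrix N (-w) := by
    have : ⅟A = A := rfl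
    rw [this]
    ext i j
    simp only [Matrix.sub_apply, Matrix.mul_apply, Fin.sum_univ_two, hA, hB, weightedCycleMatrix,
      Matrix.of_apply, Matrix.transpose_apply]
    simp
    split_ifs <;> first | (exfalso; omega) | ring
  rw [← Matrix.det_submatrix_equiv_self finSumFinEquiv, h1, Matrix.det_fromBlocks₁₁, h2]
  simp [hA]

/-- In the base cases the added edge degenerates: for N = 1 it is a loop counted twice, for N = 2 it
is parallel to the path edge. -/
theorem det_weightedCycleMatrix_one (w : ℝ) : (weightedCycleMatrix 1 w).det = 2 * w := by
  simp [weightedCycleMatrix]; ring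

theorem det_weightedCycleMatrix_two (w : ℝ) : (weightedCycleMatrix 2 w).det = -(1 + w) ^ 2 := by
  simp [weightedCycleMatrix, Matrix.det_fin_two]; ring

/-- A contraction negates both the weight and the determinant, and the base value 2w is an odd
function of w, so the signs cancel. -/
theorem det_weightedCycleMatrix_odd (k : ℕ) :
    ∀ w : ℝ, (weightedCycleMatrix (2 * k + 1) w).det = 2 * w := by
  induction k with
  | zero => exact det_weightedCycleMatrix_one
  | succ k ih =>
    intro w
    rw [show 2 * (k + 1) + 1 = 2 + (2 * k + 1) by ring,
      det_weightedCycleMatrix_two_add _ (by omega), ih]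
    ring

theorem det_weightedCycleMatrix_even (k : ℕ) :
    ∀ w : ℝ, (weightedCycleMatrix (2 * k + 2) w).det = (-1) ^ (k + 1) * (1 + (-1) ^ k * w) ^ 2 := by
  induction k with
  | zero => intro w; simp [det_weightedCycleMatrix_two]
  | succ k ih =>
    intro w
    rw [show 2 * (k + 1) + 2 = 2 + (2 * k + 2) by ring,
      det_weightedCycleMatrix_two_add _ (by omega), ih]
    ring

/-- The determinant of a path with an even number of edges. -/
theorem det_weightedCycleMatrix_zero_of_even {t : ℕ} (ht : Even t) :
    (weightedCycleMatrix (t + 1) 0).det = 0 := by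
  obtain ⟨k, rfl⟩ := ht
  rw [← two_mul, det_weightedCycleMatrix_odd, mul_zero]

/-- The determinant of a path with an odd number of edges. -/
theorem det_weightedCycleMatrix_zero_of_odd {t : ℕ} (ht : Odd t) :
    (weightedCycleMatrix (t + 1) 0).det = (-1) ^ (-(((t : ℤ) + 1) / 2)) := by
  obtain ⟨k, rfl⟩ := ht
  rw [det_weightedCycleMatrix_even]
  have : (((2 * k + 1 : ℕ) : ℤ) + 1) / 2 = ((k + 1 : ℕ) : ℤ) := by push_cast; omega
  rw [this, zpow_neg, zpow_natCast]
  rcases Nat.even_or_odd (k + 1) with h | h <;> simp [h.neg_one_pow]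

/-- The determinant of an even cycle. -/
theorem det_weightedCycleMatrix_one_of_even {t : ℕ} (ht : Even t) (h0 : 0 < t) :
    (weightedCycleMatrix t 1).det = -2 * (1 + (-1) ^ (1 - (t : ℤ) / 2)) := by
  obtain ⟨k, rfl⟩ := ht
  obtain ⟨k, rfl⟩ : ∃ m, k = m + 1 := ⟨k - 1, by omega⟩
  rw [show k + 1 + (k + 1) = 2 * k + 2 by ring, det_weightedCycleMatrix_even]
  have : 1 - ((2 * k + 2 : ℕ) : ℤ) / 2 = -(k : ℤ) := by push_cast; omega
  rw [this, zpow_neg, zpow_natCast]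
  -- Both sides are -4 for even k and 0 for odd k.
  rcases Nat.even_or_odd k with h | h
  · simp [h.neg_one_pow, pow_succ]
    norm_num
  · simp [h.neg_one_pow]

/-- The determinant of an odd cycle. -/
theorem det_weightedCycleMatrix_one_of_odd {t : ℕ} (ht : Odd t) :
    (weightedCycleMatrix t 1).det = 2 := by
  obtain ⟨k, rfl⟩ := ht
  rw [det_weightedCycleMatrix_odd, mul_one]

/-! ### The associated graph and lifts of alternating walks. -/

namespace SimpleMixedGraph

variable {V : Type*}

/-- The associated graph: two copies `(false, v)` and `(true, v)` of each vertex, the edges within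
each copy, and for each arc `u → v` an edge between `(false, u)` and `(true, v)`. -/
def associatedGraph (G : SimpleMixedGraph V) : SimpleGraph (Bool × V) where
  Adj x y := (x.1 = y.1 ∧ G.und.Adj x.2 y.2) ∨ (x.1 = false ∧ y.1 = true ∧ G.Arc x.2 y.2) ∨
    (x.1 = true ∧ y.1 = false ∧ G.Arc y.2 x.2)
  symm := ⟨by
    rintro x y (⟨h, h'⟩ | ⟨h, h', h''⟩ | ⟨h, h', h''⟩)
    · exact Or.inl ⟨h.symm, h'.symm⟩
    · exact Or.inr (Or.inr ⟨h', h, h''⟩)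
    · exact Or.inr (Or.inl ⟨h', h, h''⟩)⟩
  loopless := ⟨by
    rintro x (⟨_, h⟩ | ⟨h, h', _⟩ | ⟨h, h', _⟩)
    · exact h.ne rfl
    · simp [h] at h'
    · simp [h] at h'⟩

theorem associatedGraph_adj_same (G : SimpleMixedGraph V) {b : Bool} {u v : V} :
    G.associatedGraph.Adj (b, u) (b, v) ↔ G.und.Adj u v := by
  cases b <;> simp [associatedGraph]

theorem associatedGraph_adj_arc (G : SimpleMixedGraph V) {u v : V} :
    G.associatedGraph.Adj (false, u) (true, v) ↔ G.Arc u v := by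
  simp [associatedGraph]

namespace SubmixedGraph

variable {G : SimpleMixedGraph V}

@[ext]
theorem ext {H K : SubmixedGraph G} (h : H.toSubgraph = K.toSubgraph)
    (h' : ∀ u v, H.Arc u v ↔ K.Arc u v) : H = K := by
  obtain ⟨H, A, _, _, _⟩ := H
  obtain ⟨K, B, _, _, _⟩ := K
  obtain rfl : H = K := h
  obtain rfl : A = B := by ext u v; exact h' u v
  rfl

theorem le_antisymm {H K : SubmixedGraph G} (h : H ≤ K) (h' : K ≤ H) : H = K :=
  ext (_root_.le_antisymm h.1 h'.1) fun u v => ⟨h.2 u v, h'.2 u v⟩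

/-- The projection to `G` of a connected component of the associated graph. -/
def ofComponent (C : G.associatedGraph.ConnectedComponent) : SubmixedGraph G where
  verts := {v | ∃ b, (b, v) ∈ C.supp}
  Adj u v := G.und.Adj u v ∧ ∃ b, (b, u) ∈ C.supp
  adj_sub h := h.1
  edge_vert h := h.2
  symm := ⟨by
    rintro u v ⟨h, b, hb⟩
    exact ⟨h.symm, b, (C.mem_supp_congr_adj (G.associatedGraph_adj_same.2 h)).1 hb⟩⟩
  Arc u v := G.Arc u v ∧ (false, u) ∈ C.supp
  arc_sub h := h.1
  arc_fst_mem h := ⟨false, h.2⟩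
  arc_snd_mem h := ⟨true, (C.mem_supp_congr_adj (G.associatedGraph_adj_arc.2 h.1)).1 h.2⟩

theorem ofComponent_arc_snd {C : G.associatedGraph.ConnectedComponent} {u v : V}
    (h : (ofComponent C).Arc u v) : (true, v) ∈ C.supp :=
  (C.mem_supp_congr_adj (G.associatedGraph_adj_arc.2 h.1)).1 h.2

theorem mem_supp_of_reachable {C : G.associatedGraph.ConnectedComponent} {x y : Bool × V}
    (h : G.associatedGraph.Reachable x y) (hx : x ∈ C.supp) : y ∈ C.supp := by
  rw [SimpleGraph.ConnectedComponent.mem_supp_iff] at *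
  rw [← hx, SimpleGraph.ConnectedComponent.eq]
  exact h.symm

theorem reachable_of_mem_supp {C : G.associatedGraph.ConnectedComponent} {x y : Bool × V}
    (hx : x ∈ C.supp) (hy : y ∈ C.supp) : G.associatedGraph.Reachable x y := by
  rw [SimpleGraph.ConnectedComponent.mem_supp_iff] at *
  rw [← SimpleGraph.ConnectedComponent.eq, hx, hy]

namespace Walk

variable {H : SubmixedGraph G}

/-- `lay` assigns to each position of the walk the copy in which it lies when the walk is lifted
to the associated graph. -/
structure IsLift (W : H.Walk) (lay : ℕ → Bool) : Prop where
  edge : ∀ i < W.length, W.kind i = StepKind.edge → lay (i + 1) = lay i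
  forward : ∀ i < W.length, W.kind i = StepKind.forward → lay i = false ∧ lay (i + 1) = true
  reverse : ∀ i < W.length, W.kind i = StepKind.reverse → lay i = true ∧ lay (i + 1) = false

theorem finite_arcsBetween (W : H.Walk) (i j : ℕ) :
    {m : ℕ | i ≤ m ∧ m < j ∧ W.kind m ≠ StepKind.edge}.Finite :=
  (Set.finite_Iio j).subset fun _ h => h.2.1

theorem arcsBetween_self (W : H.Walk) (i : ℕ) : W.arcsBetween i i = 0 := by
  unfold arcsBetween
  rw [Set.ncard_eq_zero (W.finite_arcsBetween i i)]
  ext m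
  simp only [Set.mem_ofPred_eq, Set.mem_empty_iff_false, iff_false]
  omega

theorem arcsBetween_succ_of_edge (W : H.Walk) {i j : ℕ} (h : W.kind j = StepKind.edge) :
    W.arcsBetween i (j + 1) = W.arcsBetween i j := by
  unfold arcsBetween
  congr 1
  ext m
  simp only [Set.mem_ofPred_eq]
  constructor
  · rintro ⟨h1, h2, h3⟩
    exact ⟨h1, lt_of_le_of_ne (by omega) fun e => h3 (e ▸ h), h3⟩
  · rintro ⟨h1, h2, h3⟩
    exact ⟨h1, by omega, h3⟩

theorem arcsBetween_succ_of_ne_edge (W : H.Walk) {i j : ℕ} (hij : i ≤ j)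
    (h : W.kind j ≠ StepKind.edge) : W.arcsBetween i (j + 1) = W.arcsBetween i j + 1 := by
  unfold arcsBetween
  rw [← Set.ncard_insert_of_notMem (a := j) (by simp) (W.finite_arcsBetween i j)]
  congr 1
  ext m
  simp only [Set.mem_ofPred_eq, Set.mem_insert_iff]
  constructor
  · rintro ⟨h1, h2, h3⟩
    rcases eq_or_ne m j with e | e
    · exact Or.inl e
    · exact Or.inr ⟨h1, by omega, h3⟩
  · rintro (rfl | ⟨h1, h2, h3⟩)
    · exact ⟨hij, by omega, h⟩
    · exact ⟨h1, by omega, h3⟩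

theorem IsLift.succ_of_ne_edge {W : H.Walk} {lay : ℕ → Bool} (hl : W.IsLift lay) {i : ℕ}
    (hi : i < W.length) (h : W.kind i ≠ StepKind.edge) : lay (i + 1) = !lay i := by
  cases hk : W.kind i with
  | edge => exact absurd hk h
  | forward => simp [hl.forward i hi hk]
  | reverse => simp [hl.reverse i hi hk]

/-- The copy changes exactly at the arcs. This turns every parity requirement of the definitions
into a statement about copies. -/
theorem IsLift.odd_arcsBetween_iff {W : H.Walk} {lay : ℕ → Bool} (hl : W.IsLift lay) {i j : ℕ}
    (hij : i ≤ j) (hj : j ≤ W.length) : Odd (W.arcsBetween i j) ↔ lay i ≠ lay j := by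
  induction j, hij using Nat.le_induction with
  | base => simp [arcsBetween_self]
  | succ j hij ih =>
    by_cases h : W.kind j = StepKind.edge
    · rw [W.arcsBetween_succ_of_edge h, hl.edge j (by omega) h, ih (by omega)]
    · rw [W.arcsBetween_succ_of_ne_edge hij h, hl.succ_of_ne_edge (by omega) h, Nat.odd_add_one,
        ih (by omega)]
      cases lay i <;> cases lay j <;> simp

/-- Between two successive arcs the copy is constant, and two arcs in the same direction would have
to end and start in different copies. -/
theorem IsLift.isAlternating {W : H.Walk} {lay : ℕ → Bool} (hl : W.IsLift lay)
    (hH : H.arcSet.Nonempty) : W.IsAlternating := by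
  refine ⟨hH, fun i j hij hj hi' hj' hm e => ?_⟩
  have hc : ∀ m, i + 1 ≤ m → m ≤ j → lay m = lay (i + 1) := by
    intro m h1
    induction m, h1 using Nat.le_induction with
    | base => intro _; rfl
    | succ m h1 ih =>
      intro h2
      rw [hl.edge m (by omega) (hm m (by omega) (by omega)), ih (by omega)]
  have h1 := hc j hij le_rfl
  cases hk : W.kind i with
  | edge => exact hi' hk
  | forward =>
    rw [(hl.forward i (by omega) hk).2, (hl.forward j hj (e ▸ hk)).1] at h1
    simp at h1
  | reverse =>
    rw [(hl.reverse i (by omega) hk).2, (hl.reverse j hj (e ▸ hk)).1] at h1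
    simp at h1

/-- The copy in which a step of the given kind has to start if it is along an arc. -/
def _root_.SimpleMixedGraph.StepKind.startLayer : StepKind → Bool
  | StepKind.reverse => true
  | _ => false

/-- The copies visited when the walk is lifted starting from the copy `b`. -/
def layer (W : H.Walk) (b : Bool) : ℕ → Bool
  | 0 => b
  | i + 1 => match W.kind i with
    | StepKind.edge => W.layer b i
    | _ => !W.layer b i

theorem layer_succ_of_edge (W : H.Walk) (b : Bool) {i : ℕ} (h : W.kind i = StepKind.edge) :
    W.layer b (i + 1) = W.layer b i := by
  simp [layer, h]

theorem layer_succ_of_ne_edge (W : H.Walk) (b : Bool) {i : ℕ} (h : W.kind i ≠ StepKind.edge) :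
    W.layer b (i + 1) = !W.layer b i := by
  rw [layer]
  cases hk : W.kind i with
  | edge => exact absurd hk h
  | forward => rfl
  | reverse => rfl

theorem isLift_layer {W : H.Walk} {b : Bool}
    (h : ∀ i < W.length, W.kind i ≠ StepKind.edge → W.layer b i = (W.kind i).startLayer) :
    W.IsLift (W.layer b) where
  edge i _ hk := W.layer_succ_of_edge b hk
  forward i hi hk := by
    have h1 := h i hi (by simp [hk])
    rw [W.layer_succ_of_ne_edge b (by simp [hk]), h1, hk]
    exact ⟨rfl, rfl⟩
  reverse i hi hk := by
    have h1 := h i hi (by simp [hk])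
    rw [W.layer_succ_of_ne_edge b (by simp [hk]), h1, hk]
    exact ⟨rfl, rfl⟩

/-- An alternating walk lifts to the associated graph; the copy from which the lift starts can be
prescribed if the walk contains no arc. -/
theorem IsAlternating.exists_isLift {W : H.Walk} (hW : W.IsAlternating) (b : Bool) :
    ∃ lay, W.IsLift lay ∧ (lay 0 = b ∨ ∃ m < W.length, W.kind m ≠ StepKind.edge) := by
  classical
  by_cases hex : ∃ m < W.length, W.kind m ≠ StepKind.edge
  · set b₀ := (W.kind (Nat.find hex)).startLayer with hb₀
    have hfirst : ∀ m < W.length, W.kind m ≠ StepKind.edge →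
        (∀ j < m, W.kind j = StepKind.edge) → b₀ = (W.kind m).startLayer := by
      intro m hm hk hj
      have : Nat.find hex = m := (Nat.find_eq_iff hex).2 ⟨⟨hm, hk⟩, fun n hn h => h.2 (hj n hn)⟩
      rw [hb₀, this]
    -- The copy at position i is determined by the last arc before i, if there is one; alternation
    -- makes it the copy in which the next arc must start.
    have inv : ∀ i ≤ W.length,
        ((∀ j < i, W.kind j = StepKind.edge) ∧ W.layer b₀ i = b₀) ∨
        ∃ j < i, W.kind j ≠ StepKind.edge ∧ (∀ m, j < m → m < i → W.kind m = StepKind.edge) ∧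
          W.layer b₀ i = !(W.kind j).startLayer := by
      have step : ∀ i < W.length, W.kind i ≠ StepKind.edge →
          (((∀ j < i, W.kind j = StepKind.edge) ∧ W.layer b₀ i = b₀) ∨
          ∃ j < i, W.kind j ≠ StepKind.edge ∧
            (∀ m, j < m → m < i → W.kind m = StepKind.edge) ∧
            W.layer b₀ i = !(W.kind j).startLayer) →
          W.layer b₀ i = (W.kind i).startLayer := by
        rintro i hi hk (⟨h1, h2⟩ | ⟨j, h1, h2, h3, h4⟩)
        · rw [h2, hfirst i hi hk h1]
        · rw [h4]
          have := hW.2 j i h1 hi h2 hk h3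
          revert this h2 hk
          cases W.kind i <;> cases W.kind j <;> simp [StepKind.startLayer]
      intro i
      induction i with
      | zero => intro _; exact Or.inl ⟨by simp, rfl⟩
      | succ i ih =>
        intro hi
        by_cases hk : W.kind i = StepKind.edge
        · rw [W.layer_succ_of_edge b₀ hk]
          rcases ih (by omega) with ⟨h1, h2⟩ | ⟨j, h1, h2, h3, h4⟩
          · refine Or.inl ⟨fun j hj => ?_, h2⟩
            rcases Nat.lt_succ_iff_lt_or_eq.1 hj with h | rfl
            · exact h1 j h
            · exact hk
          · refine Or.inr ⟨j, by omega, h2, fun m hm hm' => ?_, h4⟩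
            rcases Nat.lt_succ_iff_lt_or_eq.1 hm' with h | rfl
            · exact h3 m hm h
            · exact hk
        · refine Or.inr ⟨i, by omega, hk, fun m _ _ => by omega, ?_⟩
          rw [W.layer_succ_of_ne_edge b₀ hk, step i (by omega) hk (ih (by omega))]
    refine ⟨W.layer b₀, isLift_layer fun i hi hk => ?_, Or.inr hex⟩
    rcases inv i hi.le with ⟨h1, h2⟩ | ⟨j, h1, h2, h3, h4⟩
    · rw [h2, hfirst i hi hk h1]
    · rw [h4]
      have := hW.2 j i h1 hi h2 hk h3
      revert this h2 hk
      cases W.kind i <;> cases W.kind j <;> simp [StepKind.startLayer]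
  · push Not at hex
    exact ⟨fun _ => b, ⟨fun _ _ _ => rfl, fun i hi hk => by simp [hex i hi] at hk,
      fun i hi hk => by simp [hex i hi] at hk⟩, Or.inl rfl⟩

/-- The vertices of the lifted walk. -/
def liftVert (W : H.Walk) (lay : ℕ → Bool) (i : ℕ) : Bool × V := (lay i, W.vert i)

theorem IsLift.adj {W : H.Walk} {lay : ℕ → Bool} (hl : W.IsLift lay) {i : ℕ}
    (hi : i < W.length) :
    G.associatedGraph.Adj (W.liftVert lay i) (W.liftVert lay (i + 1)) := by
  unfold liftVert
  cases hk : W.kind i with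
  | edge =>
    rw [hl.edge i hi hk, associatedGraph_adj_same]
    exact (W.edge_step i hi hk).adj_sub
  | forward =>
    rw [(hl.forward i hi hk).1, (hl.forward i hi hk).2, associatedGraph_adj_arc]
    exact H.arc_sub (W.forward_step i hi hk)
  | reverse =>
    rw [(hl.reverse i hi hk).1, (hl.reverse i hi hk).2, SimpleGraph.adj_comm,
      associatedGraph_adj_arc]
    exact H.arc_sub (W.reverse_step i hi hk)

theorem IsLift.reachable_zero {W : H.Walk} {lay : ℕ → Bool} (hl : W.IsLift lay) {i : ℕ}
    (hi : i ≤ W.length) :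
    G.associatedGraph.Reachable (W.liftVert lay 0) (W.liftVert lay i) := by
  induction i with
  | zero => exact SimpleGraph.Reachable.refl _
  | succ i ih => exact (ih (by omega)).trans (hl.adj (by omega)).reachable

theorem IsLift.reachable {W : H.Walk} {lay : ℕ → Bool} (hl : W.IsLift lay) {i j : ℕ}
    (hi : i ≤ W.length) (hj : j ≤ W.length) :
    G.associatedGraph.Reachable (W.liftVert lay i) (W.liftVert lay j) :=
  (hl.reachable_zero hi).symm.trans (hl.reachable_zero hj)

/-- A lifted walk that uses an arc of the projection of a component stays in the component. -/
theorem IsLift.liftVert_mem {C : G.associatedGraph.ConnectedComponent}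
    {W : (ofComponent C).Walk} {lay : ℕ → Bool} (hl : W.IsLift lay) {m : ℕ} (hm : m < W.length)
    (hk : W.kind m ≠ StepKind.edge) {i : ℕ} (hi : i ≤ W.length) :
    W.liftVert lay i ∈ C.supp := by
  refine mem_supp_of_reachable (hl.reachable hm.le hi) ?_
  unfold liftVert
  cases h : W.kind m with
  | edge => exact absurd h hk
  | forward =>
    rw [(hl.forward m hm h).1]
    exact (W.forward_step m hm h).2
  | reverse =>
    rw [(hl.reverse m hm h).1]
    exact ofComponent_arc_snd (W.reverse_step m hm h)

theorem exists_arc_of_odd_arcsBetween {W : H.Walk} {i j : ℕ} (hj : j ≤ W.length)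
    (h : Odd (W.arcsBetween i j)) : ∃ m < W.length, W.kind m ≠ StepKind.edge := by
  have : W.arcsBetween i j ≠ 0 := by rintro e; simp [e] at h
  obtain ⟨m, -, hm, hk⟩ := Set.nonempty_of_ncard_ne_zero this
  exact ⟨m, by omega, hk⟩

/-- The kind of a step between the given copies. -/
def _root_.SimpleMixedGraph.StepKind.ofLayers : Bool → Bool → StepKind
  | false, true => StepKind.forward
  | true, false => StepKind.reverse
  | _, _ => StepKind.edge

/-- The projection of a walk in a component of the associated graph. -/
def project {C : G.associatedGraph.ConnectedComponent} {x y : Bool × V}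
    (p : G.associatedGraph.Walk x y) (hx : x ∈ C.supp) : (ofComponent C).Walk :=
  have hmem : ∀ i, p.getVert i ∈ C.supp := fun i =>
    mem_supp_of_reachable ⟨p.take i⟩ hx
  { length := p.length
    vert := fun i => (p.getVert i).2
    kind := fun i => StepKind.ofLayers (p.getVert i).1 (p.getVert (i + 1)).1
    vert_mem := fun i _ => ⟨_, hmem i⟩
    edge_step := fun i hi hk => by
      refine ⟨?_, _, hmem i⟩
      rcases p.adj_getVert_succ hi with h | h | h
      · exact h.2
      · simp [h, StepKind.ofLayers] at hk
      · simp [h, StepKind.ofLayers] at hk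
    forward_step := fun i hi hk => by
      rcases p.adj_getVert_succ hi with h | h | h
      · rw [h.1] at hk
        cases h' : (p.getVert (i + 1)).1 <;> simp [h', StepKind.ofLayers] at hk
      · refine ⟨h.2.2, ?_⟩
        rw [← h.1]
        exact hmem i
      · simp [h, StepKind.ofLayers] at hk
    reverse_step := fun i hi hk => by
      rcases p.adj_getVert_succ hi with h | h | h
      · rw [h.1] at hk
        cases h' : (p.getVert (i + 1)).1 <;> simp [h', StepKind.ofLayers] at hk
      · simp [h, StepKind.ofLayers] at hk
      · refine ⟨h.2.2, ?_⟩
        rw [← h.2.1]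
        exact hmem (i + 1) }

theorem isLift_project {C : G.associatedGraph.ConnectedComponent} {x y : Bool × V}
    (p : G.associatedGraph.Walk x y) (hx : x ∈ C.supp) :
    (project p hx).IsLift fun i => (p.getVert i).1 where
  edge i _ hk := by
    revert hk
    change StepKind.ofLayers (p.getVert i).1 (p.getVert (i + 1)).1 = _ → _
    cases (p.getVert i).1 <;> cases (p.getVert (i + 1)).1 <;> simp [StepKind.ofLayers]
  forward i _ hk := by
    revert hk
    change StepKind.ofLayers (p.getVert i).1 (p.getVert (i + 1)).1 = _ → _
    cases (p.getVert i).1 <;> cases (p.getVert (i + 1)).1 <;> simp [StepKind.ofLayers]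
  reverse i _ hk := by
    revert hk
    change StepKind.ofLayers (p.getVert i).1 (p.getVert (i + 1)).1 = _ → _
    cases (p.getVert i).1 <;> cases (p.getVert (i + 1)).1 <;> simp [StepKind.ofLayers]

theorem link_eq_inl_iff {W : H.Walk} {i : ℕ} {e : Sym2 V} : W.link i = Sum.inl e ↔
    W.kind i = StepKind.edge ∧ s(W.vert i, W.vert (i + 1)) = e := by
  unfold link
  cases W.kind i <;> simp

theorem link_eq_inr_iff {W : H.Walk} {i : ℕ} {a : V × V} : W.link i = Sum.inr a ↔
    (W.kind i = StepKind.forward ∧ (W.vert i, W.vert (i + 1)) = a) ∨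
    (W.kind i = StepKind.reverse ∧ (W.vert (i + 1), W.vert i) = a) := by
  unfold link
  cases W.kind i <;> simp

/-- The edge of the associated graph used in a step of the lifted walk. -/
def liftEdge (W : H.Walk) (lay : ℕ → Bool) (i : ℕ) : Sym2 (Bool × V) :=
  s(W.liftVert lay i, W.liftVert lay (i + 1))

theorem IsLift.liftEdge_of_edge {W : H.Walk} {lay : ℕ → Bool} (hl : W.IsLift lay) {i : ℕ}
    (hi : i < W.length) {e : Sym2 V} (h : W.link i = Sum.inl e) :
    W.liftEdge lay i = e.map (Prod.mk (lay i)) := by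
  obtain ⟨hk, rfl⟩ := link_eq_inl_iff.1 h
  simp [liftEdge, liftVert, hl.edge i hi hk]

/-- An arc has a single lift, whichever way it is traversed, whereas an edge has one in each copy.
This is why arcs may occur once and edges twice. -/
theorem IsLift.liftEdge_of_arc {W : H.Walk} {lay : ℕ → Bool} (hl : W.IsLift lay) {i : ℕ}
    (hi : i < W.length) {a : V × V} (h : W.link i = Sum.inr a) :
    W.liftEdge lay i = s((false, a.1), (true, a.2)) := by
  rcases link_eq_inr_iff.1 h with ⟨hk, rfl⟩ | ⟨hk, rfl⟩
  · simp [liftEdge, liftVert, hl.forward i hi hk]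
  · simp [liftEdge, liftVert, hl.reverse i hi hk]

theorem finite_vertCount (W : H.Walk) (v : V) : {i | i ≤ W.length ∧ W.vert i = v}.Finite :=
  (Set.finite_Iic W.length).subset fun _ h => h.1

theorem finite_link (W : H.Walk) (a : Sym2 V ⊕ V × V) :
    {i | i < W.length ∧ W.link i = a}.Finite :=
  (Set.finite_Iio W.length).subset fun _ h => h.1

/-- A walk whose lift does not repeat a vertex is an alternating path. -/
theorem IsLift.isAlternatingPath {W : H.Walk} {lay : ℕ → Bool} (hl : W.IsLift lay)
    (hH : H.arcSet.Nonempty) (hinj : Set.InjOn (W.liftVert lay) (Set.Iic W.length)) :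
    W.IsAlternatingPath := by
  have hedge : ∀ i j, i < j → j < W.length → W.liftEdge lay i ≠ W.liftEdge lay j := by
    intro i j hij hj h
    rcases Sym2.eq_iff.1 h with ⟨h1, -⟩ | ⟨h1, -⟩
    · have := hinj (Set.mem_Iic.2 (by omega)) (Set.mem_Iic.2 (by omega)) h1
      omega
    · have := hinj (Set.mem_Iic.2 (by omega)) (Set.mem_Iic.2 (by omega)) h1
      omega
  have hlayer : ∀ i j e, i < j → j < W.length → W.link i = Sum.inl e → W.link j = Sum.inl e →
      lay i ≠ lay j := by
    intro i j e hij hj h1 h2 h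
    apply hedge i j hij hj
    rw [hl.liftEdge_of_edge (by omega) h1, hl.liftEdge_of_edge hj h2, h]
  refine ⟨hl.isAlternating hH, fun v => ?_, fun i j hij hj h => ?_, fun e => ?_,
    fun i j e hij hj h1 h2 => ?_, fun a => ?_⟩
  -- The occurrences of v lie in different copies, and there are only two.
  · refine (Set.ncard_le_ncard_of_injOn lay (t := Set.univ) (by simp) ?_).trans ?_
    · rintro i ⟨hi, hi'⟩ j ⟨hj, hj'⟩ h
      exact hinj hi hj (by simp [liftVert, h, hi', hj'])
    · simp
  · rw [hl.odd_arcsBetween_iff hij.le hj]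
    intro h'
    have := hinj (Set.mem_Iic.2 (by omega)) (Set.mem_Iic.2 hj)
      (show W.liftVert lay i = W.liftVert lay j by simp [liftVert, h, h'])
    omega
  · refine (Set.ncard_le_ncard_of_injOn lay (t := Set.univ) (by simp) ?_).trans ?_
    · rintro i ⟨hi, hi'⟩ j ⟨hj, hj'⟩ h
      rcases lt_trichotomy i j with h1 | h1 | h1
      · exact absurd h (hlayer i j e h1 hj hi' hj')
      · exact h1
      · exact absurd h.symm (hlayer j i e h1 hi hj' hi')
    · simp
  · rw [hl.odd_arcsBetween_iff hij hj.le, hl.edge i (by omega) (link_eq_inl_iff.1 h1).1]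
    exact hlayer i j e hij hj h1 h2
  · unfold arcCount
    rw [Set.ncard_le_one (W.finite_link _)]
    rintro i ⟨hi, hi'⟩ j ⟨hj, hj'⟩
    have h : W.liftEdge lay i = W.liftEdge lay j := by
      rw [hl.liftEdge_of_arc hi hi', hl.liftEdge_of_arc hj hj']
    rcases lt_trichotomy i j with h1 | h1 | h1
    · exact absurd h (hedge i j h1 hj)
    · exact h1
    · exact absurd h.symm (hedge j i h1 hi)

/-- Converse to `IsLift.isAlternatingPath`: an odd number of arcs puts two occurrences of a vertex
into different copies. -/
theorem IsAlternatingPath.injOn_liftVert {W : H.Walk} (hW : W.IsAlternatingPath)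
    {lay : ℕ → Bool} (hl : W.IsLift lay) : Set.InjOn (W.liftVert lay) (Set.Iic W.length) := by
  have key : ∀ i j, i < j → j ≤ W.length → W.liftVert lay i ≠ W.liftVert lay j := by
    intro i j hij hj h
    exact (hl.odd_arcsBetween_iff hij.le hj).1
      (hW.2.2.1 i j hij hj (congrArg Prod.snd h)) (congrArg Prod.fst h)
  intro i hi j hj h
  rcases lt_trichotomy i j with h1 | h1 | h1
  · exact absurd h (key i j h1 hj)
  · exact h1
  · exact absurd h.symm (key j i h1 hi)

/-- The link condition says that the lifted walk does not repeat an edge. -/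
theorem LinkCondition.liftEdge_ne {W : H.Walk} (hW : W.LinkCondition) {lay : ℕ → Bool}
    (hl : W.IsLift lay) {i j : ℕ} (hij : i < j) (hj : j < W.length) :
    W.liftEdge lay i ≠ W.liftEdge lay j := by
  intro h
  -- A lifted edge stays in one copy and a lifted arc joins the two, so `Prod.fst` excludes the
  -- mixed cases.
  cases hi' : W.link i with
  | inl e =>
    have h1 := hl.liftEdge_of_edge (by omega) hi'
    cases hj' : W.link j with
    | inl f =>
      have h2 := hl.liftEdge_of_edge hj hj'
      rw [h1, h2] at h
      have hlay : lay i = lay j := by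
        have := congrArg (Sym2.map Prod.fst) h
        clear hi' hj' h1 h2 h
        induction e with | _ u v =>
        induction f with | _ u' v' =>
        simpa using this
      have hef : e = f := by
        have := congrArg (Sym2.map Prod.snd) h
        simpa [Sym2.map_map, Function.comp_def] using this
      have := (hl.odd_arcsBetween_iff (i := i + 1) hij hj.le).1
        (hW.2.1 i j e hij hj hi' (hef ▸ hj'))
      rw [hl.edge i (by omega) (link_eq_inl_iff.1 hi').1] at this
      exact this hlay
    | inr a =>
      have h2 := hl.liftEdge_of_arc hj hj'
      rw [h1, h2] at h
      have := congrArg (Sym2.map Prod.fst) h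
      induction e with | _ u v => simp at this
  | inr a =>
    have h1 := hl.liftEdge_of_arc (by omega) hi'
    cases hj' : W.link j with
    | inl f =>
      have h2 := hl.liftEdge_of_edge hj hj'
      rw [h1, h2] at h
      have := congrArg (Sym2.map Prod.fst) h
      induction f with | _ u v => simp at this
    | inr c =>
      have h2 := hl.liftEdge_of_arc hj hj'
      rw [h1, h2] at h
      have hac : a = c := by
        simp only [Sym2.eq_iff, Prod.mk.injEq] at h
        rcases h with h | h
        · exact Prod.ext h.1.2 h.2.2
        · simp at h
      have := (Set.ncard_le_one (W.finite_link _)).1 (hW.2.2 a) i ⟨by omega, hi'⟩ j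
        ⟨hj, hac ▸ hj'⟩
      omega

end Walk

end SubmixedGraph

end SimpleMixedGraph

/-! ### Mixed components as projections of connected components. -/

namespace SimpleMixedGraph

variable {V : Type*}

namespace SubmixedGraph

variable {G : SimpleMixedGraph V}

theorem exists_isAlternating_ofComponent {C : G.associatedGraph.ConnectedComponent}
    (hC : (ofComponent C).arcSet.Nonempty) {x y : Bool × V} (hx : x ∈ C.supp) (hy : y ∈ C.supp) :
    ∃ W : (ofComponent C).Walk, W.IsAlternating ∧ W.vert 0 = x.2 ∧ W.vert W.length = y.2 ∧
      (Odd W.numArcs ↔ x.1 ≠ y.1) := by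
  obtain ⟨p⟩ := reachable_of_mem_supp hx hy
  have hl := Walk.isLift_project p hx
  refine ⟨Walk.project p hx, hl.isAlternating hC, ?_, ?_, ?_⟩
  · simp [Walk.project]
  · simp [Walk.project]
  · rw [Walk.numArcs, hl.odd_arcsBetween_iff (Nat.zero_le _) le_rfl]
    simp [Walk.project]

theorem reachable_associatedGraph_of_coe {H : SubmixedGraph G} (b : Bool) {u v : H.verts}
    (h : H.toSubgraph.coe.Reachable u v) :
    G.associatedGraph.Reachable (b, u.1) (b, v.1) :=
  h.map (⟨fun w => (b, w.1), fun h => G.associatedGraph_adj_same.2 h.adj_sub⟩ :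
    H.toSubgraph.coe →g G.associatedGraph)

/-- For clause (ii): an in-arc puts a vertex of the second copy into `C`, an out-arc one of the
first. Edges carry both to v, and a walk in `C` between the two copies of v projects to a closed
walk with an odd number of arcs. -/
theorem isSpecial_ofComponent {C : G.associatedGraph.ConnectedComponent}
    (hC : (ofComponent C).arcSet.Nonempty) : (ofComponent C).IsSpecial := by
  refine ⟨hC, ?_, ?_⟩
  · rintro u ⟨b, hu⟩ v ⟨b', hv⟩ -
    obtain ⟨W, h1, h2, h3, -⟩ := exists_isAlternating_ofComponent hC hu hv
    exact ⟨W, h1, h2, h3⟩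
  · rintro c ⟨x, hx, u, hux⟩ ⟨y, hy, w, hyw⟩ v hv
    rw [SimpleGraph.ConnectedComponent.mem_supp_iff] at hx hy hv
    have hxv : (ofComponent C).toSubgraph.coe.Reachable x v := by
      rw [← SimpleGraph.ConnectedComponent.eq, hx, hv]
    have hyv : (ofComponent C).toSubgraph.coe.Reachable y v := by
      rw [← SimpleGraph.ConnectedComponent.eq, hy, hv]
    have h1 := mem_supp_of_reachable (reachable_associatedGraph_of_coe true hxv)
      (ofComponent_arc_snd hux)
    have h2 := mem_supp_of_reachable (reachable_associatedGraph_of_coe false hyv) hyw.2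
    obtain ⟨W, h3, h4, h5, h6⟩ := exists_isAlternating_ofComponent hC h2 h1
    exact ⟨W, h3, h4, h5, h6.2 (by simp)⟩

/-- The copy `x` of a vertex of `H` is active if an edge path in this copy leads from it to the
end of a lifted arc of `H`. -/
def IsActive (H : SubmixedGraph G) (x : Bool × V) : Prop :=
  ∃ w z : H.verts, w.1 = x.2 ∧ H.toSubgraph.coe.Reachable w z ∧
    ((x.1 = false ∧ ∃ y, H.Arc z y) ∨ (x.1 = true ∧ ∃ y, H.Arc y z))

variable {H : SubmixedGraph G}

theorem isActive_of_arc_fst {u v : V} (h : H.Arc u v) : H.IsActive (false, u) :=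
  ⟨⟨u, H.arc_fst_mem h⟩, ⟨u, H.arc_fst_mem h⟩, rfl, SimpleGraph.Reachable.refl _,
    Or.inl ⟨rfl, v, h⟩⟩

theorem isActive_of_arc_snd {u v : V} (h : H.Arc u v) : H.IsActive (true, v) :=
  ⟨⟨v, H.arc_snd_mem h⟩, ⟨v, H.arc_snd_mem h⟩, rfl, SimpleGraph.Reachable.refl _,
    Or.inr ⟨rfl, u, h⟩⟩

theorem IsActive.of_adj {b : Bool} {u v : V} (hu : H.IsActive (b, u)) (h : H.Adj u v) :
    H.IsActive (b, v) := by
  obtain ⟨w, z, rfl, hwz, hz⟩ := hu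
  refine ⟨⟨v, H.edge_vert h.symm⟩, z, rfl, SimpleGraph.Reachable.trans ?_ hwz, hz⟩
  exact SimpleGraph.Adj.reachable (G := H.toSubgraph.coe) h.symm

/-- Both ends of a lifted arc are active and edges preserve activity, so activity is constant along
a lift. -/
theorem Walk.IsLift.isActive_zero_iff {W : H.Walk} {lay : ℕ → Bool} (hl : W.IsLift lay) {i : ℕ}
    (hi : i ≤ W.length) :
    H.IsActive (W.liftVert lay 0) ↔ H.IsActive (W.liftVert lay i) := by
  induction i with
  | zero => rfl
  | succ i ih =>
    rw [ih (by omega)]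
    unfold Walk.liftVert
    have hi' : i < W.length := hi
    cases hk : W.kind i with
    | edge =>
      rw [hl.edge i hi' hk]
      exact ⟨fun h => h.of_adj (W.edge_step i hi' hk), fun h => h.of_adj (W.edge_step i hi' hk).symm⟩
    | forward =>
      rw [(hl.forward i hi' hk).1, (hl.forward i hi' hk).2]
      exact iff_of_true (isActive_of_arc_fst (W.forward_step i hi' hk))
        (isActive_of_arc_snd (W.forward_step i hi' hk))
    | reverse =>
      rw [(hl.reverse i hi' hk).1, (hl.reverse i hi' hk).2]
      exact iff_of_true (isActive_of_arc_snd (W.reverse_step i hi' hk))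
        (isActive_of_arc_fst (W.reverse_step i hi' hk))

theorem Walk.IsLift.isActive_of_ne_edge {W : H.Walk} {lay : ℕ → Bool} (hl : W.IsLift lay) {m : ℕ}
    (hm : m < W.length) (hk : W.kind m ≠ StepKind.edge) : H.IsActive (W.liftVert lay m) := by
  unfold Walk.liftVert
  cases h : W.kind m with
  | edge => exact absurd h hk
  | forward =>
    rw [(hl.forward m hm h).1]
    exact isActive_of_arc_fst (W.forward_step m hm h)
  | reverse =>
    rw [(hl.reverse m hm h).1]
    exact isActive_of_arc_snd (W.reverse_step m hm h)

/-- This is the use of clause (ii): if both copies are active, the undirected component has in-arcs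
and out-arcs, and the lift of its odd closed walk joins the two copies of v. -/
theorem IsSpecial.reachable_of_isActive_false_true (hH : H.IsSpecial) {v : V}
    (h : H.IsActive (false, v)) (h' : H.IsActive (true, v)) :
    G.associatedGraph.Reachable (false, v) (true, v) := by
  obtain ⟨w, z, rfl, hwz, hz⟩ := h
  obtain ⟨w', z', hw', hwz', hz'⟩ := h'
  obtain rfl : w' = w := Subtype.ext hw'
  simp only [true_and, Bool.false_eq_true, false_and, or_false, Bool.true_eq_false,
    false_or] at hz hz'
  obtain ⟨W, hW, h0, hk, hodd⟩ := hH.2.2 (H.toSubgraph.coe.connectedComponentMk w')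
    ⟨z', SimpleGraph.ConnectedComponent.sound hwz'.symm, hz'⟩
    ⟨z, SimpleGraph.ConnectedComponent.sound hwz.symm, hz⟩ w' rfl
  obtain ⟨lay, hl, -⟩ := hW.exists_isLift false
  have h1 := (hl.odd_arcsBetween_iff (Nat.zero_le _) le_rfl).1 hodd
  have h2 := hl.reachable_zero le_rfl
  unfold Walk.liftVert at h2
  rw [h0, hk] at h2
  revert h1 h2
  cases lay 0 <;> cases lay W.length <;> simp
  exact SimpleGraph.Reachable.symm

theorem IsSpecial.reachable_of_isActive (hH : H.IsSpecial) {v : V} {b b' : Bool}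
    (h : H.IsActive (b, v)) (h' : H.IsActive (b', v)) :
    G.associatedGraph.Reachable (b, v) (b', v) := by
  cases b <;> cases b'
  · exact SimpleGraph.Reachable.refl _
  · exact hH.reachable_of_isActive_false_true h h'
  · exact (hH.reachable_of_isActive_false_true h' h).symm
  · exact SimpleGraph.Reachable.refl _

/-- A special submixed graph is contained in the projection of the component that contains the
lift of one of its arcs. -/
theorem IsSpecial.le_ofComponent (hH : H.IsSpecial) {u₀ v₀ : V} (h₀ : H.Arc u₀ v₀)
    {C : G.associatedGraph.ConnectedComponent} (hC : (false, u₀) ∈ C.supp) :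
    H ≤ ofComponent C := by
  -- Activity is recorded because the inactive copy of w need not lie in `C`.
  have key : ∀ w ∈ H.verts, ∃ b, H.IsActive (b, w) ∧ (b, w) ∈ C.supp := by
    intro w hw
    rcases eq_or_ne u₀ w with rfl | hne
    · exact ⟨false, isActive_of_arc_fst h₀, hC⟩
    obtain ⟨W, hW, h0, hk⟩ := hH.2.1 u₀ (H.arc_fst_mem h₀) w hw hne
    -- The lift may be forced to start at (true, u₀). It then uses an arc, so this copy is active
    -- and connected to (false, u₀).
    obtain ⟨lay, hl, hb⟩ := hW.exists_isLift false
    have h1 : H.IsActive (W.liftVert lay 0) := by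
      rcases hb with hb | ⟨m, hm, hb⟩
      · rw [Walk.liftVert, hb, h0]
        exact isActive_of_arc_fst h₀
      · exact (hl.isActive_zero_iff hm.le).2 (hl.isActive_of_ne_edge hm hb)
    have h2 := (hl.isActive_zero_iff le_rfl).1 h1
    have h3 := hl.reachable_zero le_rfl
    simp only [Walk.liftVert, h0, hk] at h1 h2 h3
    exact ⟨_, h2, mem_supp_of_reachable
      ((hH.reachable_of_isActive (isActive_of_arc_fst h₀) h1).trans h3) hC⟩
  refine ⟨⟨fun w hw => ?_, fun u v h => ?_⟩, fun u v h => ⟨H.arc_sub h, ?_⟩⟩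
  · obtain ⟨b, -, hb⟩ := key w hw
    exact ⟨b, hb⟩
  · obtain ⟨b, -, hb⟩ := key u (H.edge_vert h)
    exact ⟨h.adj_sub, b, hb⟩
  -- The copy found may be the wrong one, but (false, u) is active because of the arc itself.
  · obtain ⟨b, hb, hb'⟩ := key u (H.arc_fst_mem h)
    exact mem_supp_of_reachable (hH.reachable_of_isActive hb (isActive_of_arc_fst h)) hb'

/-- A special submixed graph containing the projection shares an arc with it, so
`IsSpecial.le_ofComponent` bounds it by the same projection. -/
theorem maximal_isSpecial_ofComponent {C : G.associatedGraph.ConnectedComponent}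
    (hC : (ofComponent C).arcSet.Nonempty) : Maximal IsSpecial (ofComponent C) := by
  refine ⟨isSpecial_ofComponent hC, fun K hK hle => ?_⟩
  obtain ⟨⟨u, v⟩, h⟩ := hC
  exact hK.le_ofComponent (hle.2 u v h) h.2

theorem exists_eq_ofComponent_of_maximal (hH : Maximal IsSpecial H) :
    ∃ C : G.associatedGraph.ConnectedComponent, (ofComponent C).arcSet.Nonempty ∧
      H = ofComponent C := by
  obtain ⟨⟨u, v⟩, h⟩ := hH.1.1
  refine ⟨G.associatedGraph.connectedComponentMk (false, u), ?_, ?_⟩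
  · exact ⟨(u, v), H.arc_sub h, rfl⟩
  · have hle := hH.1.le_ofComponent h (C := G.associatedGraph.connectedComponentMk (false, u)) rfl
    exact le_antisymm hle (hH.2 (isSpecial_ofComponent ⟨(u, v), H.arc_sub h, rfl⟩) hle)

/-- A component of the associated graph that lies in one copy. -/
def _root_.SimpleMixedGraph.IsFlat (b : Bool) (C : G.associatedGraph.ConnectedComponent) : Prop :=
  ∀ x ∈ C.supp, x.1 = b

theorem arcSet_ofComponent_of_isFlat {b : Bool} {C : G.associatedGraph.ConnectedComponent}
    (hC : IsFlat b C) : (ofComponent C).arcSet = ∅ := by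
  rw [Set.eq_empty_iff_forall_notMem]
  rintro ⟨u, v⟩ h
  have h1 := hC _ h.2
  have h2 := hC _ (ofComponent_arc_snd h)
  simp only at h1 h2
  simp [← h2] at h1

theorem mem_supp_iff_of_isFlat {b : Bool} {C : G.associatedGraph.ConnectedComponent}
    (hC : IsFlat b C) {v : V} : v ∈ (ofComponent C).verts ↔ (b, v) ∈ C.supp := by
  constructor
  · rintro ⟨b', h⟩
    obtain rfl : b' = b := hC _ h
    exact h
  · exact fun h => ⟨b, h⟩

/-- A component that cannot leave a copy projects to a component of the undirected part. -/
theorem fst_eq_and_reachable_of_mem_supp {C : G.associatedGraph.ConnectedComponent} {b : Bool} {v : V}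
    (hv : (b, v) ∈ C.supp)
    (hC : ∀ w, G.und.Reachable v w → ∀ y, G.associatedGraph.Adj (b, w) y → y.1 = b)
    {x : Bool × V} (hx : x ∈ C.supp) : x.1 = b ∧ G.und.Reachable v x.2 := by
  obtain ⟨p⟩ := reachable_of_mem_supp hv hx
  have : ∀ i ≤ p.length, (p.getVert i).1 = b ∧ G.und.Reachable v (p.getVert i).2 := by
    intro i
    induction i with
    | zero => intro _; simp
    | succ i ih =>
      intro hi
      obtain ⟨h1, h2⟩ := ih (by omega)
      have h3 := p.adj_getVert_succ (show i < p.length from hi)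
      have h4 : p.getVert i = (b, (p.getVert i).2) := Prod.ext h1 rfl
      rw [h4] at h3
      have h5 := hC _ h2 _ h3
      refine ⟨h5, h2.trans ?_⟩
      have h6 : p.getVert (i + 1) = (b, (p.getVert (i + 1)).2) := Prod.ext h5 rfl
      rw [h6, associatedGraph_adj_same] at h3
      exact h3.reachable
  have h := this p.length le_rfl
  rwa [p.getVert_length] at h

theorem toSubgraph_ofComponent_of_isFlat {b : Bool} {C : G.associatedGraph.ConnectedComponent}
    (hC : IsFlat b C) {v : V} (hv : (b, v) ∈ C.supp) : (ofComponent C).toSubgraph =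
      (⊤ : G.und.Subgraph).induce (G.und.connectedComponentMk v).supp := by
  have key : ∀ w, (b, w) ∈ C.supp ↔ w ∈ (G.und.connectedComponentMk v).supp := by
    intro w
    rw [(G.und.connectedComponentMk v).mem_supp_iff, SimpleGraph.ConnectedComponent.eq]
    constructor
    · intro hw
      refine (fst_eq_and_reachable_of_mem_supp hv (fun w hw y hy => ?_) hw).2.symm
      refine hC _ (mem_supp_of_reachable (SimpleGraph.Reachable.trans ?_ hy.reachable) hv)
      exact hw.map (⟨fun w => (b, w), fun h => G.associatedGraph_adj_same.2 h⟩ :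
        G.und →g G.associatedGraph)
    · intro hw
      refine mem_supp_of_reachable ?_ hv
      exact hw.symm.map (⟨fun w => (b, w), fun h => G.associatedGraph_adj_same.2 h⟩ :
        G.und →g G.associatedGraph)
  apply SimpleGraph.Subgraph.ext
  · ext w
    exact (mem_supp_iff_of_isFlat hC).trans (key w)
  · ext u w
    simp only [SimpleGraph.Subgraph.induce_adj, SimpleGraph.Subgraph.top_adj, ← key]
    constructor
    · rintro ⟨h, b', hb⟩
      obtain rfl : b' = b := hC _ hb
      exact ⟨hb, (C.mem_supp_congr_adj (G.associatedGraph_adj_same.2 h)).1 hb, h⟩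
    · rintro ⟨h1, -, h2⟩
      exact ⟨h2, b, h1⟩

/-- Leaving a copy requires a lifted arc, whose projection would lie in the arc set. -/
theorem exists_isFlat_of_arcSet_eq_empty {C : G.associatedGraph.ConnectedComponent}
    (hC : (ofComponent C).arcSet = ∅) : ∃ b, IsFlat b C := by
  obtain ⟨⟨b, v⟩, hv⟩ := C.nonempty_supp
  refine ⟨b, fun x hx => (fst_eq_and_reachable_of_mem_supp hv (fun w hw y hy => ?_) hx).1⟩
  have hw' : (b, w) ∈ C.supp := by
    refine mem_supp_of_reachable ?_ hv
    exact hw.map (⟨fun w => (b, w), fun h => G.associatedGraph_adj_same.2 h⟩ :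
      G.und →g G.associatedGraph)
  rw [Set.eq_empty_iff_forall_notMem] at hC
  rcases hy with h | ⟨h1, h2, h3⟩ | ⟨h1, h2, h3⟩
  · exact h.1.symm
  · simp only at h1
    subst h1
    exact absurd ⟨h3, hw'⟩ (hC (w, y.2))
  · simp only at h1
    subst h1
    refine absurd ⟨h3, ?_⟩ (hC (y.2, w))
    have : y = (false, y.2) := Prod.ext h2 rfl
    rw [← this]
    exact (C.mem_supp_congr_adj (Or.inr (Or.inr ⟨rfl, h2, h3⟩))).1 hw'

end SubmixedGraph

open SubmixedGraph

variable {G : SimpleMixedGraph V}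

/-- The position of a component of the associated graph that belongs to a type of mixed
components. -/
def ComponentType.Fits (τ : ComponentType) (C : G.associatedGraph.ConnectedComponent) : Prop :=
  match τ with
  | ComponentType.I => IsFlat false C
  | ComponentType.II => IsFlat true C
  | ComponentType.III => (ofComponent C).arcSet.Nonempty

theorem isFlat_unique {b b' : Bool} {C : G.associatedGraph.ConnectedComponent}
    (h : IsFlat b C) (h' : IsFlat b' C) : b = b' := by
  obtain ⟨x, hx⟩ := C.nonempty_supp
  rw [← h x hx, ← h' x hx]

theorem ComponentType.Fits.eq {τ τ' : ComponentType}
    {C : G.associatedGraph.ConnectedComponent} (h : τ.Fits C) (h' : τ'.Fits C) : τ = τ' := by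
  have h1 : ∀ {b}, IsFlat b C → ¬ (ofComponent C).arcSet.Nonempty := fun hb hn => by
    simp [arcSet_ofComponent_of_isFlat hb] at hn
  cases τ <;> cases τ' <;> simp only [ComponentType.Fits] at h h' <;> first
    | rfl
    | exact absurd (isFlat_unique h h') (by simp)
    | exact absurd h (h1 h')
    | exact absurd h' (h1 h)

theorem ComponentType.exists_fits (C : G.associatedGraph.ConnectedComponent) :
    ∃ τ : ComponentType, τ.Fits C := by
  rcases Set.eq_empty_or_nonempty (ofComponent C).arcSet with h | h
  · obtain ⟨b, hb⟩ := exists_isFlat_of_arcSet_eq_empty h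
    cases b
    · exact ⟨ComponentType.I, hb⟩
    · exact ⟨ComponentType.II, hb⟩
  · exact ⟨ComponentType.III, h⟩

theorem isUndComponent_ofComponent_of_isFlat {b : Bool}
    {C : G.associatedGraph.ConnectedComponent} (hC : IsFlat b C) :
    (ofComponent C).IsUndComponent := by
  refine ⟨arcSet_ofComponent_of_isFlat hC, ?_⟩
  obtain ⟨⟨b', v⟩, hv⟩ := C.nonempty_supp
  obtain rfl : b' = b := hC _ hv
  exact ⟨_, toSubgraph_ofComponent_of_isFlat hC hv⟩

theorem isMixedComponent_ofComponent {τ : ComponentType}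
    {C : G.associatedGraph.ConnectedComponent} (h : τ.Fits C) :
    G.IsMixedComponent τ (ofComponent C) := by
  cases τ
  · have h : IsFlat false C := h
    refine ⟨isUndComponent_ofComponent_of_isFlat h, fun v hv u huv => ?_⟩
    have := arcSet_ofComponent_of_isFlat h
    rw [Set.eq_empty_iff_forall_notMem] at this
    exact this (v, u) ⟨huv, (mem_supp_iff_of_isFlat h).1 hv⟩
  · have h : IsFlat true C := h
    refine ⟨isUndComponent_ofComponent_of_isFlat h, fun v hv u huv => ?_⟩
    have h1 := (C.mem_supp_congr_adj (G.associatedGraph_adj_arc.2 huv)).2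
      ((mem_supp_iff_of_isFlat h).1 hv)
    simpa using h _ h1
  · exact maximal_isSpecial_ofComponent h

theorem exists_ofComponent_of_isUndComponent {b : Bool} {H : SubmixedGraph G}
    (hH : H.IsUndComponent)
    (hb : ∀ v ∈ H.verts, ∀ y, G.associatedGraph.Adj (b, v) y → y.1 = b) :
    ∃ C : G.associatedGraph.ConnectedComponent, IsFlat b C ∧ H = ofComponent C := by
  obtain ⟨hA, c, hc⟩ := hH
  induction c using SimpleGraph.ConnectedComponent.ind with | _ v =>
  have hflat : IsFlat b (G.associatedGraph.connectedComponentMk (b, v)) := by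
    intro x hx
    refine (fst_eq_and_reachable_of_mem_supp (v := v) rfl (fun w hw y hy => hb w ?_ y hy) hx).1
    rw [hc]
    exact SimpleGraph.ConnectedComponent.sound hw.symm
  refine ⟨_, hflat, SubmixedGraph.ext ?_ fun u w => ?_⟩
  · rw [hc, toSubgraph_ofComponent_of_isFlat hflat rfl]
  · have h1 := Set.eq_empty_iff_forall_notMem.1 hA (u, w)
    have h2 := Set.eq_empty_iff_forall_notMem.1 (arcSet_ofComponent_of_isFlat hflat) (u, w)
    exact iff_of_false h1 h2

theorem IsMixedComponent.exists_ofComponent {τ : ComponentType} {H : SubmixedGraph G}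
    (h : G.IsMixedComponent τ H) :
    ∃ C : G.associatedGraph.ConnectedComponent, τ.Fits C ∧ H = ofComponent C := by
  cases τ
  · refine exists_ofComponent_of_isUndComponent h.1 fun v hv y hy => ?_
    rcases hy with hy | hy | hy
    · exact hy.1.symm
    · exact absurd hy.2.2 (h.2 v hv _)
    · simp at hy
  · refine exists_ofComponent_of_isUndComponent h.1 fun v hv y hy => ?_
    rcases hy with hy | hy | hy
    · exact hy.1.symm
    · simp at hy
    · exact absurd hy.2.2 (h.2 v hv _)
  · exact exists_eq_ofComponent_of_maximal h

/-- The type cannot be dropped: a component of `G_u` that meets no arc has two flat lifts with the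
same projection. -/
theorem ComponentType.Fits.component_eq {τ : ComponentType}
    {C C' : G.associatedGraph.ConnectedComponent} (h : τ.Fits C) (h' : τ.Fits C')
    (e : ofComponent C = ofComponent C') : C = C' := by
  have flat : ∀ b, IsFlat b C → IsFlat b C' → C = C' := by
    intro b hb hb'
    obtain ⟨⟨b', v⟩, hv⟩ := C.nonempty_supp
    obtain rfl : b' = b := hb _ hv
    have h1 := (mem_supp_iff_of_isFlat hb).2 hv
    rw [e] at h1
    exact C.eq_of_common_vertex hv ((mem_supp_iff_of_isFlat hb').1 h1)
  cases τ
  · exact flat _ h h'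
  · exact flat _ h h'
  · obtain ⟨⟨u, v⟩, hu⟩ := h
    have h1 : (ofComponent C').Arc u v := e ▸ hu
    exact C.eq_of_common_vertex hu.2 h1.2

/-- The mixed components of `G` correspond to the components of the associated graph. -/
theorem exists_equiv_connectedComponent (G : SimpleMixedGraph V) :
    ∃ e : G.MixedComponent ≃ G.associatedGraph.ConnectedComponent,
      ∀ M, M.graph = ofComponent (e M) := by
  choose f hf hf' using fun M : G.MixedComponent => M.isMixedComponent.exists_ofComponent
  refine ⟨Equiv.ofBijective f ⟨fun M M' h => ?_, fun C => ?_⟩, hf'⟩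
  · have h1 : M.graph = M'.graph := by rw [hf' M, hf' M', h]
    have h2 : M.type = M'.type := (hf M).eq (h ▸ hf M')
    obtain ⟨τ, K, _⟩ := M
    obtain ⟨τ', K', _⟩ := M'
    obtain rfl : τ = τ' := h2
    obtain rfl : K = K' := h1
    rfl
  · obtain ⟨τ, hτ⟩ := ComponentType.exists_fits C
    refine ⟨⟨τ, ofComponent C, isMixedComponent_ofComponent hτ⟩, ?_⟩
    exact ((hf _).component_eq hτ (hf' _).symm)

end SimpleMixedGraph

/-! ### Lifts of the walks of the AP and AC properties. -/

/-- A shortest walk between two pairs of vertices meets each pair only in one of its ends; so two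
disjoint edges of a connected graph lie on a common path. -/
theorem SimpleGraph.Reachable.exists_isPath_between_pairs {X : Type*} {Γ : SimpleGraph X}
    {a a' b b' : X} (hab : Γ.Reachable a b) :
    ∃ x y z w, s(x, y) = s(a, a') ∧ s(z, w) = s(b, b') ∧
      ∃ p : Γ.Walk y z, p.IsPath ∧ (x ≠ y → x ∉ p.support) ∧ (w ≠ z → w ∉ p.support) := by
  classical
  have hex : ∃ n, ∃ x y z w, s(x, y) = s(a, a') ∧ s(z, w) = s(b, b') ∧
      ∃ p : Γ.Walk y z, p.length = n := by
    obtain ⟨p⟩ := hab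
    exact ⟨_, a', a, b, b', Sym2.eq_swap, rfl, p, rfl⟩
  obtain ⟨x, y, z, w, h1, h2, p, hp⟩ := Nat.find_spec hex
  have hmin : ∀ x y z w, s(x, y) = s(a, a') → s(z, w) = s(b, b') →
      ∀ q : Γ.Walk y z, Nat.find hex ≤ q.length :=
    fun x y z w h1 h2 q => Nat.find_min' hex ⟨x, y, z, w, h1, h2, q, rfl⟩
  have hb : p.bypass.length ≤ Nat.find hex := hp ▸ p.length_bypass_le_length
  refine ⟨x, y, z, w, h1, h2, p.bypass, p.bypass_isPath, fun hne hx => ?_, fun hne hw => ?_⟩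
  -- If the path met x, its part from x on, with the roles of x and y exchanged, would be a shorter
  -- competitor.
  · have h3 := hmin y x z w (Sym2.eq_swap.trans h1) h2 (p.bypass.dropUntil x hx)
    have h4 := congrArg SimpleGraph.Walk.length (p.bypass.take_spec hx)
    rw [SimpleGraph.Walk.length_append] at h4
    have h5 : (p.bypass.takeUntil x hx).length = 0 := by omega
    exact hne (SimpleGraph.Walk.eq_of_length_eq_zero h5).symm
  · have h3 := hmin x y w z h1 (Sym2.eq_swap.trans h2) (p.bypass.takeUntil w hw)
    have h4 := congrArg SimpleGraph.Walk.length (p.bypass.take_spec hw)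
    rw [SimpleGraph.Walk.length_append] at h4
    have h5 : (p.bypass.dropUntil w hw).length = 0 := by omega
    exact hne (SimpleGraph.Walk.eq_of_length_eq_zero h5)

theorem Set.ncard_eq_sum_ite {α : Type*} [Fintype α] (s : Set α) [DecidablePred (· ∈ s)] :
    s.ncard = ∑ x, if x ∈ s then 1 else 0 := by
  rw [Set.ncard_eq_toFinset_card', Finset.sum_boole]
  rw [Nat.cast_id]
  congr 1
  ext x
  simp

namespace SimpleMixedGraph

variable {V : Type*}

namespace SubmixedGraph

variable {G : SimpleMixedGraph V}

open Classical in
/-- The walk visits every edge and arc as often as its number of lifts. -/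
structure Walk.Covers {H : SubmixedGraph G} (W : H.Walk) : Prop where
  arc : ∀ a ∈ H.arcSet, W.arcCount a = 1
  edge : ∀ e ∈ H.edgeSet, W.edgeCount e = if e ∈ H.Omega then 2 else 1

/-- Sort the steps by the link they use: each edge counts once, each edge of Ω once more, each arc
once. -/
theorem Walk.Covers.t_eq_length [Finite V] {H : SubmixedGraph G} {W : H.Walk} (hW : W.Covers) :
    H.t = W.length := by
  classical
  have := Fintype.ofFinite V
  have hcount : ∀ c, ((Finset.range W.length).filter (W.link · = c)).card =
      {i | i < W.length ∧ W.link i = c}.ncard := by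
    intro c
    rw [← Set.ncard_coe_finset]
    congr 1
    ext i
    simp
  have hE : ∀ e, W.edgeCount e = (if e ∈ H.edgeSet then 1 else 0) +
      (if e ∈ H.Omega then 1 else 0) := by
    intro e
    by_cases he : e ∈ H.edgeSet
    · rw [hW.edge e he]
      split_ifs <;> rfl
    · have h1 : e ∉ H.Omega := fun h => he h.1
      rw [if_neg he, if_neg h1, Walk.edgeCount, Set.ncard_eq_zero (W.finite_link _),
        Set.eq_empty_iff_forall_notMem]
      rintro i ⟨hi, h⟩
      obtain ⟨hk, rfl⟩ := Walk.link_eq_inl_iff.1 h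
      exact he (W.edge_step i hi hk)
  have hA : ∀ a, W.arcCount a = (if a ∈ H.arcSet then 1 else 0) := by
    intro a
    by_cases ha : a ∈ H.arcSet
    · rw [hW.arc a ha, if_pos ha]
    · rw [if_neg ha, Walk.arcCount, Set.ncard_eq_zero (W.finite_link _),
        Set.eq_empty_iff_forall_notMem]
      rintro i ⟨hi, h⟩
      rcases Walk.link_eq_inr_iff.1 h with ⟨hk, rfl⟩ | ⟨hk, rfl⟩
      · exact ha (W.forward_step i hi hk)
      · exact ha (W.reverse_step i hi hk)
  have h := Finset.card_eq_sum_card_fiberwise (s := Finset.range W.length) (t := Finset.univ)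
    (f := W.link) (by simp)
  rw [Finset.card_range, Fintype.sum_sum_type] at h
  simp only [hcount] at h
  change W.length = ∑ e, W.edgeCount e + ∑ a, W.arcCount a at h
  simp only [hE, hA, Finset.sum_add_distrib, ← Set.ncard_eq_sum_ite] at h
  rw [h, t]

variable {C : G.associatedGraph.ConnectedComponent}

/-- The two occurrences of v on an alternating path are separated by an odd number of arcs, so they
lie in different copies; having an arc, the lift stays in `C`. -/
theorem mem_supp_of_mem_theta {v : V} (hv : v ∈ (ofComponent C).Theta) (b : Bool) :
    (b, v) ∈ C.supp := by
  obtain ⟨-, W, hW, h2⟩ := hv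
  obtain ⟨i, j, hij, h⟩ := Set.ncard_eq_two.1 h2
  have hi : i ∈ {i | i ≤ W.length ∧ W.vert i = v} := by rw [h]; simp
  have hj : j ∈ {i | i ≤ W.length ∧ W.vert i = v} := by rw [h]; simp
  have key : ∀ i j, i < j → i ∈ {i | i ≤ W.length ∧ W.vert i = v} →
      j ∈ {i | i ≤ W.length ∧ W.vert i = v} → (b, v) ∈ C.supp := by
    rintro i j hij ⟨hi, hi'⟩ ⟨hj, hj'⟩
    have hodd := hW.2.2.1 i j hij hj (hi'.trans hj'.symm)
    obtain ⟨lay, hl, -⟩ := hW.1.exists_isLift false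
    obtain ⟨m, hm, hk⟩ := Walk.exists_arc_of_odd_arcsBetween hj hodd
    have h1 := hl.liftVert_mem hm hk hi
    have h2 := hl.liftVert_mem hm hk hj
    rw [hl.odd_arcsBetween_iff hij.le hj] at hodd
    rw [Walk.liftVert, hi'] at h1
    rw [Walk.liftVert, hj'] at h2
    rcases eq_or_ne (lay i) b with e | e
    · rwa [e] at h1
    · have : lay j = b := by
        revert e hodd
        cases lay i <;> cases lay j <;> cases b <;> simp
      rwa [this] at h2
  rcases lt_or_gt_of_ne hij with h | h
  · exact key i j h hi hj
  · exact key j i h hj hi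

/-- The two lifts of the edge are disjoint edges of `C`, so some path of `C` uses both; its
projection is an alternating path with the edge twice. -/
theorem mem_omega_of_mem_supp (hC : (ofComponent C).arcSet.Nonempty) {u v : V}
    (huv : G.und.Adj u v) (h : (false, u) ∈ C.supp) (h' : (true, u) ∈ C.supp) :
    s(u, v) ∈ (ofComponent C).Omega := by
  refine ⟨⟨huv, false, h⟩, ?_⟩
  obtain ⟨x, y, z, w, h1, h2, p, hp, hx, hw⟩ :=
    (reachable_of_mem_supp h h').exists_isPath_between_pairs (a' := (false, v)) (b' := (true, v))
  have hxy : G.associatedGraph.Adj x y := by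
    rw [← SimpleGraph.mem_edgeSet, h1]
    exact G.associatedGraph_adj_same.2 huv
  have hzw : G.associatedGraph.Adj z w := by
    rw [← SimpleGraph.mem_edgeSet, h2]
    exact G.associatedGraph_adj_same.2 huv
  have hx1 : x.1 = false ∧ y.1 = false := by
    rcases Sym2.eq_iff.1 h1 with ⟨rfl, rfl⟩ | ⟨rfl, rfl⟩ <;> simp
  have hw1 : z.1 = true ∧ w.1 = true := by
    rcases Sym2.eq_iff.1 h2 with ⟨rfl, rfl⟩ | ⟨rfl, rfl⟩ <;> simp
  -- The ends x and w of the extended path differ because they lie in different copies.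
  have hq : (SimpleGraph.Walk.cons hxy (p.concat hzw)).IsPath := by
    rw [SimpleGraph.Walk.cons_isPath_iff, SimpleGraph.Walk.concat_isPath_iff]
    refine ⟨⟨hp, hw hzw.ne'⟩, ?_⟩
    rw [SimpleGraph.Walk.support_concat, List.mem_append]
    rintro (h3 | h3)
    · exact hx hxy.ne h3
    · rw [List.mem_singleton] at h3
      rw [h3, hw1.2] at hx1
      simp at hx1
  have hxC : x ∈ C.supp := by
    rcases Sym2.eq_iff.1 h1 with ⟨rfl, rfl⟩ | ⟨rfl, rfl⟩
    · exact h
    · exact (C.mem_supp_congr_adj hxy).2 h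
  set q := SimpleGraph.Walk.cons hxy (p.concat hzw) with hqdef
  have hlen : q.length = p.length + 2 := by
    simp [hqdef, SimpleGraph.Walk.length_concat]
  have hl := Walk.isLift_project q hxC
  have hpath : (Walk.project q hxC).IsAlternatingPath := by
    refine hl.isAlternatingPath hC fun i hi j hj hij => ?_
    exact hq.getVert_injOn hi hj hij
  refine ⟨_, hpath, _root_.le_antisymm (hpath.2.2.2.1 _) ?_⟩
  have g0 : q.getVert 0 = x := by simp
  have g1 : q.getVert 1 = y := by simp [hqdef]
  have g2 : q.getVert (p.length + 1) = z := by
    rw [hqdef, SimpleGraph.Walk.getVert_cons_succ, SimpleGraph.Walk.concat_eq_append,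
      SimpleGraph.Walk.getVert_append]
    simp
  have g3 : q.getVert (p.length + 1 + 1) = w := by
    rw [show p.length + 1 + 1 = q.length by omega, SimpleGraph.Walk.getVert_length]
  have hlink : ∀ (i : ℕ) (β : Bool), q.getVert i = (β, (q.getVert i).2) →
      q.getVert (i + 1) = (β, (q.getVert (i + 1)).2) →
      s((q.getVert i).2, (q.getVert (i + 1)).2) = s(u, v) →
      (Walk.project q hxC).link i = Sum.inl s(u, v) := by
    intro i β h3 h4 h5
    rw [Walk.link_eq_inl_iff]
    refine ⟨?_, h5⟩
    change StepKind.ofLayers (q.getVert i).1 (q.getVert (i + 1)).1 = _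
    rw [h3, h4]
    cases β <;> rfl
  refine (Set.one_lt_ncard (Walk.finite_link _ _)).2 ⟨0, ⟨?_, ?_⟩, p.length + 1, ⟨?_, ?_⟩, ?_⟩
  · change 0 < q.length
    omega
  · refine hlink 0 false ?_ ?_ ?_
    · rw [g0, ← hx1.1]
    · rw [zero_add, g1, ← hx1.2]
    · rw [zero_add, g0, g1]
      simpa using congrArg (Sym2.map Prod.snd) h1
  · change p.length + 1 < q.length
    omega
  · refine hlink _ true ?_ ?_ ?_
    · rw [g2, ← hw1.1]
    · rw [g3, ← hw1.2]
    · rw [g2, g3]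
      simpa using congrArg (Sym2.map Prod.snd) h2
  · omega

theorem Walk.Covers.exists_arc (hC : (ofComponent C).arcSet.Nonempty) {W : (ofComponent C).Walk}
    (hW : W.Covers) : ∃ m < W.length, W.kind m ≠ StepKind.edge := by
  obtain ⟨a, ha⟩ := hC
  obtain ⟨m, hm, h⟩ := Set.nonempty_of_ncard_ne_zero
    (show W.arcCount a ≠ 0 by rw [hW.arc a ha]; simp)
  refine ⟨m, hm, fun hk => ?_⟩
  simp [Walk.link_eq_inr_iff, hk] at h

/-- The lift of a covering walk uses all edges of the component. -/
theorem Walk.Covers.exists_liftEdge (hC : (ofComponent C).arcSet.Nonempty)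
    {W : (ofComponent C).Walk} (hW : W.Covers) (hlink : W.LinkCondition) {lay : ℕ → Bool}
    (hl : W.IsLift lay) {x y : Bool × V} (hx : x ∈ C.supp) (hxy : G.associatedGraph.Adj x y) :
    ∃ m < W.length, W.liftEdge lay m = s(x, y) := by
  have arc : ∀ u v, (false, u) ∈ C.supp → G.Arc u v →
      ∃ m < W.length, W.liftEdge lay m = s((false, u), (true, v)) := by
    intro u v hu huv
    obtain ⟨m, hm, h⟩ := Set.nonempty_of_ncard_ne_zero
      (show W.arcCount (u, v) ≠ 0 by rw [hW.arc (u, v) ⟨huv, hu⟩]; simp)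
    exact ⟨m, hm, hl.liftEdge_of_arc hm h⟩
  obtain ⟨b, u⟩ := x
  obtain ⟨b', v⟩ := y
  have hy := (C.mem_supp_congr_adj hxy).1 hx
  rcases hxy with ⟨h1, h2⟩ | ⟨h1, h2, h3⟩ | ⟨h1, h2, h3⟩
  · simp only at h1 h2
    subst h1
    have he : s(u, v) ∈ (ofComponent C).edgeSet := ⟨h2, b, hx⟩
    have hcount := hW.edge _ he
    have conclude : ∀ m < W.length, W.link m = Sum.inl s(u, v) → lay m = b →
        ∃ m < W.length, W.liftEdge lay m = s((b, u), (b, v)) := by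
      intro m hm h h'
      refine ⟨m, hm, ?_⟩
      rw [hl.liftEdge_of_edge hm h, h']
      simp
    split_ifs at hcount with hΩ
    · obtain ⟨i, j, hij, h⟩ := Set.ncard_eq_two.1 hcount
      have hi : i ∈ {i | i < W.length ∧ W.link i = Sum.inl s(u, v)} := by rw [h]; simp
      have hj : j ∈ {i | i < W.length ∧ W.link i = Sum.inl s(u, v)} := by rw [h]; simp
      -- No lifted edge is repeated, so the two occurrences use both lifts, among them the one in
      -- copy b.
      have hne : lay i ≠ lay j := by
        intro e
        have h3 : W.liftEdge lay i = W.liftEdge lay j := by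
          rw [hl.liftEdge_of_edge hi.1 hi.2, hl.liftEdge_of_edge hj.1 hj.2, e]
        rcases lt_or_gt_of_ne hij with h | h
        · exact hlink.liftEdge_ne hl h hj.1 h3
        · exact hlink.liftEdge_ne hl h hi.1 h3.symm
      rcases eq_or_ne (lay i) b with e | e
      · exact conclude i hi.1 hi.2 e
      · refine conclude j hj.1 hj.2 ?_
        revert e hne
        cases lay i <;> cases lay j <;> cases b <;> simp
    · obtain ⟨m, hm, h⟩ := Set.nonempty_of_ncard_ne_zero
        (show W.edgeCount s(u, v) ≠ 0 by rw [hcount]; simp)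
      refine conclude m hm h ?_
      -- If the only visit were in the other copy, both lifts would lie in `C` and the edge would
      -- belong to Ω.
      by_contra hne
      obtain ⟨m', hm', hk⟩ := hW.exists_arc hC
      have h4 := hl.liftVert_mem hm' hk hm.le
      have h5 := hl.liftVert_mem hm' hk (show m + 1 ≤ W.length from hm)
      have h6 : (lay m, u) ∈ C.supp := by
        obtain ⟨hk', h⟩ := Walk.link_eq_inl_iff.1 h
        rw [Walk.liftVert] at h4 h5
        rw [hl.edge m hm hk'] at h5
        rcases Sym2.eq_iff.1 h with ⟨h7, -⟩ | ⟨-, h7⟩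
        · rwa [h7] at h4
        · rwa [h7] at h5
      apply hΩ
      revert hne hx h6
      cases lay m <;> cases b <;> simp only [not_true_eq_false, false_implies, implies_true,
        Bool.false_eq_true, Bool.true_eq_false, not_false_eq_true, true_implies]
      · exact fun h h' => mem_omega_of_mem_supp hC h2 h' h
      · exact fun h h' => mem_omega_of_mem_supp hC h2 h h'
  · simp only at h1 h2 h3
    subst h1 h2
    exact arc u v hx h3
  · simp only at h1 h2 h3
    subst h1 h2
    obtain ⟨m, hm, h⟩ := arc v u hy h3
    exact ⟨m, hm, h.trans Sym2.eq_swap⟩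

/-- The component contains a lifted arc, hence has no isolated vertex, and an edge at x is used by
the lift. -/
theorem Walk.Covers.exists_liftVert (hC : (ofComponent C).arcSet.Nonempty)
    {W : (ofComponent C).Walk} (hW : W.Covers) (hlink : W.LinkCondition) {lay : ℕ → Bool}
    (hl : W.IsLift lay) {x : Bool × V} (hx : x ∈ C.supp) :
    ∃ m ≤ W.length, W.liftVert lay m = x := by
  obtain ⟨y, hy⟩ : ∃ y, G.associatedGraph.Adj x y := by
    obtain ⟨⟨u, v⟩, huv⟩ := hC
    have h1 : (false, u) ∈ C.supp := huv.2
    have h2 := ofComponent_arc_snd huv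
    have key : ∀ z ∈ C.supp, x ≠ z → ∃ y, G.associatedGraph.Adj x y := fun z hz hne =>
      (SimpleGraph.mem_support _).1
        (SimpleGraph.mem_support_of_reachable hne (reachable_of_mem_supp hx hz))
    by_cases e : x = (false, u)
    · exact key _ h2 (by simp [e])
    · exact key _ h1 e
  obtain ⟨m, hm, h⟩ := hW.exists_liftEdge hC hlink hl hx hy
  rcases Sym2.eq_iff.1 h with ⟨h, -⟩ | ⟨-, h⟩
  · exact ⟨m, hm.le, h⟩
  · exact ⟨m + 1, hm, h⟩

/-- A component of the associated graph is a path with `t` edges if its projection has an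
alternating path as in the AP property. -/
theorem Walk.Covers.exists_equiv_of_isAlternatingPath [Finite V] {W : (ofComponent C).Walk}
    (hW : W.Covers) (hpath : W.IsAlternatingPath) :
    ∃ e : Fin ((ofComponent C).t + 1) ≃ C.supp, ∀ i j,
      G.associatedGraph.Adj (e i) (e j) ↔ i.val + 1 = j.val ∨ j.val + 1 = i.val := by
  have hC := hpath.1.1
  rw [hW.t_eq_length]
  obtain ⟨lay, hl, -⟩ := hpath.1.exists_isLift false
  obtain ⟨m, hm, hk⟩ := hW.exists_arc hC
  have hinj := hpath.injOn_liftVert hl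
  have hlink := hpath.2.2.2
  let f : Fin (W.length + 1) → C.supp := fun i =>
    ⟨W.liftVert lay i, hl.liftVert_mem hm hk (Nat.lt_succ_iff.1 i.2)⟩
  have hf : Function.Bijective f := by
    refine ⟨fun i j h => ?_, fun x => ?_⟩
    · exact Fin.ext (hinj (Nat.lt_succ_iff.1 i.2) (Nat.lt_succ_iff.1 j.2) (congrArg Subtype.val h))
    · obtain ⟨i, hi, h⟩ := hW.exists_liftVert hC hlink hl x.2
      exact ⟨⟨i, Nat.lt_succ_iff.2 hi⟩, Subtype.ext h⟩
  refine ⟨Equiv.ofBijective f hf, fun i j => ?_⟩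
  change G.associatedGraph.Adj (W.liftVert lay i) (W.liftVert lay j) ↔ _
  have hi := Nat.lt_succ_iff.1 i.2
  have hj := Nat.lt_succ_iff.1 j.2
  constructor
  -- There are no chords: every edge of `C` is a step of the lift, so its ends are consecutive.
  · intro h
    obtain ⟨m', hm', h'⟩ := hW.exists_liftEdge hC hlink hl (f i).2 h
    rcases Sym2.eq_iff.1 h' with ⟨h1, h2⟩ | ⟨h1, h2⟩
    · have h3 := hinj hm'.le hi h1
      have h4 := hinj (show m' + 1 ≤ W.length from hm') hj h2
      omega
    · have h3 := hinj hm'.le hj h1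
      have h4 := hinj (show m' + 1 ≤ W.length from hm') hi h2
      omega
  · rintro (h | h)
    · rw [← h]
      exact hl.adj (by omega)
    · rw [← h]
      exact (hl.adj (by omega)).symm

-- The vertex counts leave no room for a repetition. If the lift met a copy of v twice, then for v
-- in Θ the other copy, which is also visited, would give an occurrence too many. For the starting
-- vertex the closing position is one more.
open Classical in
theorem Walk.Covers.injOn_liftVert_of_isAlternatingCycle (hC : (ofComponent C).arcSet.Nonempty)
    {W : (ofComponent C).Walk} (hW : W.Covers) (hcyc : W.IsAlternatingCycle)
    {lay : ℕ → Bool} (hl : W.IsLift lay) (hlay : lay 0 = lay W.length)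
    (h0 : W.vertCount (W.vert 0) = if W.vert 0 ∈ (ofComponent C).Theta then 3 else 2)
    (hv : ∀ v ∈ (ofComponent C).verts, v ≠ W.vert 0 →
      W.vertCount v = if v ∈ (ofComponent C).Theta then 2 else 1) :
    Set.InjOn (W.liftVert lay) (Set.Iio W.length) := by
  have key : ∀ i j, i < j → j < W.length → W.liftVert lay i ≠ W.liftVert lay j := by
    intro i j hij hj h
    have hvij : W.vert i = W.vert j := congrArg Prod.snd h
    have hlij : lay i = lay j := congrArg Prod.fst h
    have hle : ∀ s : Finset ℕ, (∀ m ∈ s, m ≤ W.length ∧ W.vert m = W.vert i) →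
        s.card ≤ W.vertCount (W.vert i) := by
      intro s hs
      rw [← Set.ncard_coe_finset]
      exact Set.ncard_le_ncard hs (W.finite_vertCount _)
    have hother : W.vert i ∈ (ofComponent C).Theta →
        ∃ m ≤ W.length, W.vert m = W.vert i ∧ lay m ≠ lay i := by
      intro hΘ
      obtain ⟨m, hm, hm'⟩ := hW.exists_liftVert hC hcyc.2.2 hl
        (mem_supp_of_mem_theta hΘ (!lay i))
      refine ⟨m, hm, congrArg Prod.snd hm', ?_⟩
      rw [show lay m = !lay i from congrArg Prod.fst hm']
      simp
    by_cases hi0 : W.vert i = W.vert 0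
    · have h3 := hle {i, j, W.length} (by
        simp only [Finset.mem_insert, Finset.mem_singleton]
        rintro m (rfl | rfl | rfl)
        · exact ⟨by omega, rfl⟩
        · exact ⟨by omega, hvij.symm⟩
        · exact ⟨le_rfl, by rw [hi0, hcyc.2.1]⟩)
      rw [Finset.card_eq_three.2 ⟨i, j, W.length, by omega, by omega, by omega, rfl⟩, hi0, h0]
        at h3
      split_ifs at h3 with hΘ
      · rw [← hi0] at hΘ
        obtain ⟨m, hm, hm', hlm⟩ := hother hΘ
        -- A fourth position is needed beside i, j and the end. If the other copy was found at the
        -- end, position 0 lies in that same copy and serves instead.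
        have h4 : ∃ n, n ≠ i ∧ n ≠ j ∧ n ≠ W.length ∧ n ≤ W.length ∧ W.vert n = W.vert i := by
          have h5 : m ≠ i := fun e => hlm (by rw [e])
          have h6 : m ≠ j := fun e => hlm (by rw [e, hlij])
          by_cases h7 : m = W.length
          · rw [h7, ← hlay] at hlm
            refine ⟨0, ?_, ?_, by omega, by omega, hi0.symm⟩
            · exact fun e => hlm (by rw [e])
            · exact fun e => hlm (by rw [hlij, e])
          · exact ⟨m, h5, h6, h7, hm, hm'⟩
        obtain ⟨n, hn1, hn2, hn3, hn4, hn5⟩ := h4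
        have h8 := hle {n, i, j, W.length} (by
          simp only [Finset.mem_insert, Finset.mem_singleton]
          rintro m (rfl | rfl | rfl | rfl)
          · exact ⟨hn4, hn5⟩
          · exact ⟨by omega, rfl⟩
          · exact ⟨by omega, hvij.symm⟩
          · exact ⟨le_rfl, by rw [hi0, hcyc.2.1]⟩)
        rw [Finset.card_insert_of_notMem (by simp [hn1, hn2, hn3]),
          Finset.card_eq_three.2 ⟨i, j, W.length, by omega, by omega, by omega, rfl⟩, hi0, h0,
          if_pos (hi0 ▸ hΘ)] at h8
        omega
      · omega
    · have h1 := hv _ (W.vert_mem i (by omega)) hi0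
      have h3 := hle {i, j} (by
        simp only [Finset.mem_insert, Finset.mem_singleton]
        rintro m (rfl | rfl)
        · exact ⟨by omega, rfl⟩
        · exact ⟨by omega, hvij.symm⟩)
      rw [Finset.card_pair (by omega), h1] at h3
      split_ifs at h3 with hΘ
      · obtain ⟨m, hm, hm', hlm⟩ := hother hΘ
        have h8 := hle {m, i, j} (by
          simp only [Finset.mem_insert, Finset.mem_singleton]
          rintro n (rfl | rfl | rfl)
          · exact ⟨hm, hm'⟩
          · exact ⟨by omega, rfl⟩
          · exact ⟨by omega, hvij.symm⟩)
        rw [Finset.card_eq_three.2 ⟨m, i, j, fun e => hlm (by rw [e]),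
          fun e => hlm (by rw [e, hlij]), by omega, rfl⟩, h1, if_pos hΘ] at h8
        omega
      · omega
  intro i hi j hj h
  rcases lt_trichotomy i j with h1 | h1 | h1
  · exact absurd h (key i j h1 hj)
  · exact h1
  · exact absurd h.symm (key j i h1 hi)

open Classical in
/-- A component of the associated graph is a cycle with `t` edges if its projection has an
alternating cycle as in the AC property. -/
theorem Walk.Covers.exists_equiv_of_isAlternatingCycle [Finite V] {W : (ofComponent C).Walk}
    (hW : W.Covers) (hcyc : W.IsAlternatingCycle) (heven : Even W.numArcs)
    (h0 : W.vertCount (W.vert 0) = if W.vert 0 ∈ (ofComponent C).Theta then 3 else 2)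
    (hv : ∀ v ∈ (ofComponent C).verts, v ≠ W.vert 0 →
      W.vertCount v = if v ∈ (ofComponent C).Theta then 2 else 1) :
    3 ≤ (ofComponent C).t ∧ ∃ e : Fin (ofComponent C).t ≃ C.supp, ∀ i j,
      G.associatedGraph.Adj (e i) (e j) ↔ (i.val + 1 = j.val ∨ j.val + 1 = i.val) ∨
        (i.val = 0 ∧ j.val + 1 = (ofComponent C).t) ∨
        (j.val = 0 ∧ i.val + 1 = (ofComponent C).t) := by
  have hC := hcyc.1.1
  rw [hW.t_eq_length]
  obtain ⟨lay, hl, -⟩ := hcyc.1.exists_isLift false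
  obtain ⟨m, hm, hk⟩ := hW.exists_arc hC
  have hlink := hcyc.2.2
  -- An even number of arcs means that the lift itself closes up.
  have hlay : lay 0 = lay W.length := by
    by_contra h
    exact Nat.not_odd_iff_even.2 heven ((hl.odd_arcsBetween_iff (Nat.zero_le _) le_rfl).2 h)
  have hclosed : W.liftVert lay W.length = W.liftVert lay 0 := by
    simp [Walk.liftVert, hlay, hcyc.2.1]
  have hinj := hW.injOn_liftVert_of_isAlternatingCycle hC hcyc hl hlay h0 hv
  -- Length 1 would be a loop, and length 2 would traverse one lifted edge twice.
  have hthree : 3 ≤ W.length := by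
    by_contra hlt
    obtain h | h : W.length = 1 ∨ W.length = 2 := by omega
    · have h1 := hl.adj (show 0 < W.length by omega)
      rw [h] at hclosed
      rw [zero_add, hclosed] at h1
      exact h1.ne rfl
    · refine hlink.liftEdge_ne hl (show 0 < 1 by omega) (by omega) ?_
      rw [h] at hclosed
      simp only [Walk.liftEdge, zero_add]
      rw [show 1 + 1 = 2 from rfl, hclosed]
      exact Sym2.eq_swap
  refine ⟨hthree, ?_⟩
  let f : Fin W.length → C.supp := fun i => ⟨W.liftVert lay i, hl.liftVert_mem hm hk i.2.le⟩
  have hf : Function.Bijective f := by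
    refine ⟨fun i j h => Fin.ext (hinj i.2 j.2 (congrArg Subtype.val h)), fun x => ?_⟩
    obtain ⟨i, hi, h⟩ := hW.exists_liftVert hC hlink hl x.2
    rcases hi.lt_or_eq with hi | rfl
    · exact ⟨⟨i, hi⟩, Subtype.ext h⟩
    · exact ⟨⟨0, by omega⟩, Subtype.ext (hclosed.symm.trans h)⟩
  refine ⟨Equiv.ofBijective f hf, fun i j => ?_⟩
  change G.associatedGraph.Adj (W.liftVert lay i) (W.liftVert lay j) ↔ _
  have hi := i.2
  have hj := j.2
  have hadj0 := hl.adj (show W.length - 1 < W.length by omega)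
  rw [Nat.sub_add_cancel (by omega), hclosed] at hadj0
  have hnext : ∀ m < W.length, ∀ n < W.length, W.liftVert lay (m + 1) = W.liftVert lay n →
      m + 1 = n ∨ (n = 0 ∧ m + 1 = W.length) := by
    intro m hm n hn h
    rcases Nat.lt_or_ge (m + 1) W.length with h1 | h1
    · exact Or.inl (hinj h1 hn h)
    · have h2 : m + 1 = W.length := by omega
      rw [h2, hclosed] at h
      exact Or.inr ⟨(hinj (show 0 < W.length by omega) hn h).symm, h2⟩
  constructor
  · intro h
    obtain ⟨m', hm', h'⟩ := hW.exists_liftEdge hC hlink hl (f i).2 h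
    rcases Sym2.eq_iff.1 h' with ⟨h1, h2⟩ | ⟨h1, h2⟩
    · have h3 := hinj hm' hi h1
      have h4 := hnext m' hm' j hj h2
      omega
    · have h3 := hinj hm' hj h1
      have h4 := hnext m' hm' i hi h2
      omega
  · rintro ((h | h) | ⟨h, h'⟩ | ⟨h, h'⟩)
    · rw [← h]
      exact hl.adj hi
    · rw [← h]
      exact (hl.adj hj).symm
    · rw [h, show j.val = W.length - 1 by omega]
      exact hadj0.symm
    · rw [h, show i.val = W.length - 1 by omega]
      exact hadj0

end SubmixedGraph

end SimpleMixedGraph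

/-! ### Undirected paths and cycles, and the shape of all components. -/

theorem SimpleGraph.ncard_edgeSet_pathGraph (m : ℕ) :
    (SimpleGraph.pathGraph (m + 1)).edgeSet.ncard = m := by
  refine Set.ncard_eq_of_bijective
    (fun i hi => s((⟨i, by omega⟩ : Fin (m + 1)), (⟨i + 1, by omega⟩ : Fin (m + 1)))) ?_ ?_ ?_
  · intro a
    induction a with | _ u v =>
    intro h
    rw [SimpleGraph.mem_edgeSet, SimpleGraph.pathGraph_adj] at h
    rcases h with h | h
    · refine ⟨u, by omega, ?_⟩
      rw [Sym2.eq_iff]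
      exact Or.inl ⟨rfl, Fin.ext h⟩
    · refine ⟨v, by omega, ?_⟩
      rw [Sym2.eq_iff]
      exact Or.inr ⟨rfl, Fin.ext h⟩
  · intro i hi
    rw [SimpleGraph.mem_edgeSet, SimpleGraph.pathGraph_adj]
    exact Or.inl rfl
  · intro i j hi hj h
    simp only [Sym2.eq_iff, Fin.mk.injEq] at h
    omega

theorem SimpleGraph.ncard_edgeSet_cycleGraph {m : ℕ} (hm : 3 ≤ m) :
    (SimpleGraph.cycleGraph m).edgeSet.ncard = m := by
  obtain ⟨n, rfl⟩ : ∃ n, m = n + 3 := ⟨m - 3, by omega⟩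
  have h := (SimpleGraph.cycleGraph (n + 3)).sum_degrees_eq_twice_card_edges
  simp only [SimpleGraph.cycleGraph_degree_three_le, Finset.sum_const, Finset.card_univ,
    Fintype.card_fin, smul_eq_mul] at h
  rw [← SimpleGraph.coe_edgeFinset, Set.ncard_coe_finset]
  omega

theorem SimpleGraph.cycleGraph_adj_iff_val {m : ℕ} (hm : 3 ≤ m) (i j : Fin m) :
    (SimpleGraph.cycleGraph m).Adj i j ↔ (i.val + 1 = j.val ∨ j.val + 1 = i.val) ∨
      (i.val = 0 ∧ j.val + 1 = m) ∨ (j.val = 0 ∧ i.val + 1 = m) := by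
  rw [SimpleGraph.cycleGraph_adj']
  rcases lt_trichotomy i j with h | h | h
  · have h' : i.val < j.val := h
    rw [Fin.coe_sub_iff_lt.2 h, Fin.coe_sub_iff_le.2 h.le]
    omega
  · subst h
    rw [Fin.coe_sub_iff_le.2 le_rfl]
    omega
  · have h' : j.val < i.val := h
    rw [Fin.coe_sub_iff_lt.2 h, Fin.coe_sub_iff_le.2 h.le]
    omega

namespace SimpleMixedGraph

variable {V : Type*}

namespace SubmixedGraph

variable {G : SimpleMixedGraph V} {C : G.associatedGraph.ConnectedComponent}

/-- Alternating walks need an arc to exist, so Ω is empty and only edges count. -/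
theorem t_eq_of_arcSet_eq_empty {H : SubmixedGraph G} (hH : H.arcSet = ∅) {m : ℕ}
    {Γ : SimpleGraph (Fin m)} (φ : H.toSubgraph.coe ≃g Γ) : H.t = Γ.edgeSet.ncard := by
  have hΩ : H.Omega = ∅ := by
    rw [Set.eq_empty_iff_forall_notMem]
    rintro e ⟨-, W, hW, -⟩
    have := hW.1.1
    simp [hH] at this
  rw [t, hΩ, hH, Set.ncard_empty, Set.ncard_empty, add_zero, add_zero,
    ← SimpleGraph.Subgraph.image_coe_edgeSet_coe,
    Set.ncard_image_of_injective _ (Sym2.map.injective Subtype.val_injective)]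
  exact Nat.card_congr φ.mapEdgeSet

theorem exists_equiv_of_isFlat {b : Bool} (hC : IsFlat b C) {m : ℕ} {Γ : SimpleGraph (Fin m)}
    (φ : (ofComponent C).toSubgraph.coe ≃g Γ) :
    ∃ e : Fin m ≃ C.supp, ∀ i j, G.associatedGraph.Adj (e i) (e j) ↔ Γ.Adj i j := by
  let ψ : (ofComponent C).verts ≃ C.supp :=
    { toFun := fun v => ⟨(b, v.1), (mem_supp_iff_of_isFlat hC).1 v.2⟩
      invFun := fun x => ⟨x.1.2, ⟨x.1.1, x.2⟩⟩
      left_inv := fun _ => rfl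
      right_inv := fun x => Subtype.ext (Prod.ext (hC _ x.2).symm rfl) }
  refine ⟨φ.toEquiv.symm.trans ψ, fun i j => ?_⟩
  rw [← φ.symm.map_adj_iff]
  change G.associatedGraph.Adj (b, (φ.symm i).1) (b, (φ.symm j).1) ↔
    G.und.Adj _ _ ∧ (φ.symm i).1 ∈ (ofComponent C).verts
  rw [associatedGraph_adj_same]
  exact ⟨fun h => ⟨h, (φ.symm i).2⟩, And.left⟩

/-- The components of the associated graph that belong to mixed components with the AP property
are paths with `t` edges. -/
theorem AP.exists_equiv [Finite V] (h : (ofComponent C).AP) :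
    ∃ e : Fin ((ofComponent C).t + 1) ≃ C.supp, ∀ i j,
      G.associatedGraph.Adj (e i) (e j) ↔ i.val + 1 = j.val ∨ j.val + 1 = i.val := by
  rcases h with ⟨hA, m, ⟨φ⟩⟩ | ⟨W, hW, -, harc, hedge⟩
  · obtain ⟨b, hb⟩ := exists_isFlat_of_arcSet_eq_empty hA
    rw [t_eq_of_arcSet_eq_empty hA φ, SimpleGraph.ncard_edgeSet_pathGraph]
    simpa only [SimpleGraph.pathGraph_adj] using exists_equiv_of_isFlat hb φ
  · exact Walk.Covers.exists_equiv_of_isAlternatingPath ⟨harc, hedge⟩ hW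

/-- The components of the associated graph that belong to mixed components with the AC property
are cycles with `t` edges. -/
theorem AC.exists_equiv [Finite V] (h : (ofComponent C).AC) :
    3 ≤ (ofComponent C).t ∧ ∃ e : Fin (ofComponent C).t ≃ C.supp, ∀ i j,
      G.associatedGraph.Adj (e i) (e j) ↔ (i.val + 1 = j.val ∨ j.val + 1 = i.val) ∨
        (i.val = 0 ∧ j.val + 1 = (ofComponent C).t) ∨
        (j.val = 0 ∧ i.val + 1 = (ofComponent C).t) := by
  rcases h with ⟨hA, m, hm, ⟨φ⟩⟩ | ⟨W, hW, heven, h0, hv, harc, hedge⟩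
  · obtain ⟨b, hb⟩ := exists_isFlat_of_arcSet_eq_empty hA
    rw [t_eq_of_arcSet_eq_empty hA φ, SimpleGraph.ncard_edgeSet_cycleGraph hm]
    refine ⟨hm, ?_⟩
    simpa only [SimpleGraph.cycleGraph_adj_iff_val hm] using exists_equiv_of_isFlat hb φ
  · exact Walk.Covers.exists_equiv_of_isAlternatingCycle ⟨harc, hedge⟩ hW heven h0 hv

end SubmixedGraph

open SubmixedGraph

/-! ### Factorization of the determinant over components. -/

section Determinant

variable {G : SimpleMixedGraph V}

open Classical in
/-- The determinant of the adjacency matrix of a component of the associated graph. -/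
noncomputable def componentDet [Finite V] (C : G.associatedGraph.ConnectedComponent) : ℝ :=
  letI := Fintype.ofFinite C.supp
  (Matrix.of fun x y : C.supp => if G.associatedGraph.Adj x y then (1 : ℝ) else 0).det

open Classical in
theorem componentDet_eq_of_equiv [Finite V] {C : G.associatedGraph.ConnectedComponent} {m : ℕ}
    (e : Fin m ≃ C.supp) : componentDet C =
      (Matrix.of fun i j : Fin m =>
        if G.associatedGraph.Adj (e i) (e j) then (1 : ℝ) else 0).det := by
  let _ := Fintype.ofFinite C.supp
  unfold componentDet
  rw [← Matrix.det_submatrix_equiv_self e]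
  rfl

theorem componentDet_of_AP [Finite V] {C : G.associatedGraph.ConnectedComponent}
    (h : (ofComponent C).AP) :
    componentDet C = (weightedCycleMatrix ((ofComponent C).t + 1) 0).det := by
  obtain ⟨e, he⟩ := h.exists_equiv
  rw [componentDet_eq_of_equiv e]
  congr 1
  ext i j
  simp [weightedCycleMatrix, he]

theorem componentDet_of_AC [Finite V] {C : G.associatedGraph.ConnectedComponent}
    (h : (ofComponent C).AC) :
    componentDet C = (weightedCycleMatrix (ofComponent C).t 1).det := by
  obtain ⟨h3, e, he⟩ := h.exists_equiv
  rw [componentDet_eq_of_equiv e]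
  congr 1
  ext i j
  simp only [weightedCycleMatrix, he, Matrix.of_apply]
  -- As t ≥ 3, the closing edge is not also a path edge and no entry becomes 2.
  split_ifs <;> first | (exfalso; omega) | norm_num

theorem card_supp_of_AP [Finite V] {C : G.associatedGraph.ConnectedComponent}
    (h : (ofComponent C).AP) : Nat.card C.supp = (ofComponent C).t + 1 := by
  obtain ⟨e, -⟩ := h.exists_equiv
  rw [← Nat.card_congr e, Nat.card_fin]

theorem card_supp_of_AC [Finite V] {C : G.associatedGraph.ConnectedComponent}
    (h : (ofComponent C).AC) : Nat.card C.supp = (ofComponent C).t := by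
  obtain ⟨-, e, -⟩ := h.exists_equiv
  rw [← Nat.card_congr e, Nat.card_fin]

theorem det_integratedAdjMatrix_eq_prod [Fintype V] [DecidableEq V] (G : SimpleMixedGraph V)
    [Fintype G.associatedGraph.ConnectedComponent] :
    G.integratedAdjMatrix.det = ∏ C : G.associatedGraph.ConnectedComponent, componentDet C := by
  classical
  set M : Matrix (Bool × V) (Bool × V) ℝ :=
    Matrix.of fun x y => if G.associatedGraph.Adj x y then 1 else 0 with hM
  have h1 : G.integratedAdjMatrix.submatrix (Equiv.boolProdEquivSum V)
      (Equiv.boolProdEquivSum V) = M := by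
    ext ⟨b, u⟩ ⟨b', v⟩
    cases b <;> cases b' <;>
      simp [integratedAdjMatrix, hM, arcMatrix, associatedGraph, Equiv.boolProdEquivSum,
        SimpleGraph.adjMatrix_apply]
  rw [← Matrix.det_submatrix_equiv_self (Equiv.boolProdEquivSum V), h1]
  -- Any order will do, since all blocks off the diagonal vanish.
  let _ : LinearOrder G.associatedGraph.ConnectedComponent :=
    LinearOrder.lift' (Fintype.equivFin _) (Fintype.equivFin _).injective
  have h2 : M.BlockTriangular G.associatedGraph.connectedComponentMk := by
    intro x y hxy
    rw [hM, Matrix.of_apply, if_neg]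
    intro h
    exact hxy.ne (SimpleGraph.ConnectedComponent.sound h.reachable).symm
  rw [h2.det_fintype]
  refine Finset.prod_congr rfl fun C _ => ?_
  unfold componentDet
  have e : ∀ (inst : Fintype C.supp) (inst' : DecidableEq C.supp),
      (M.toSquareBlock G.associatedGraph.connectedComponentMk C).det =
      @Matrix.det C.supp inst' inst ℝ _
        (Matrix.of fun x y : C.supp => if G.associatedGraph.Adj x y then (1 : ℝ) else 0) := by
    intro inst inst'
    let ε : C.supp ≃ {x // G.associatedGraph.connectedComponentMk x = C} :=
      Equiv.subtypeEquivRight fun x => C.mem_supp_iff x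
    rw [← Matrix.det_submatrix_equiv_self ε]
    congr 1
  exact e _ _

theorem sum_card_supp [Fintype V] (G : SimpleMixedGraph V)
    [Fintype G.associatedGraph.ConnectedComponent] :
    ∑ C : G.associatedGraph.ConnectedComponent, Nat.card C.supp = 2 * Fintype.card V := by
  have h := Nat.card_congr (Equiv.sigmaFiberEquiv G.associatedGraph.connectedComponentMk)
  rw [Nat.card_sigma, Nat.card_prod, Nat.card_eq_fintype_card (α := Bool), Fintype.card_bool,
    Nat.card_eq_fintype_card (α := V)] at h
  exact h

end Determinant

end SimpleMixedGraph

/-! ### Signs and the final expansion. -/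

theorem Finset.prod_zpow_eq_zpow_sum {ι K : Type*} [Field K] {a : K} (ha : a ≠ 0) (s : Finset ι)
    (f : ι → ℤ) : ∏ i ∈ s, a ^ f i = a ^ ∑ i ∈ s, f i := by
  classical
  induction s using Finset.induction_on with
  | empty => simp
  | insert i s hi ih => rw [Finset.prod_insert hi, Finset.sum_insert hi, ih, zpow_add₀ ha]

namespace SimpleMixedGraph

open SubmixedGraph

/-- The contribution of a mixed component with the AC property, up to the factor `-2`. -/
noncomputable def cycleFactor (t : ℕ) : ℝ :=
  if Even t then 1 + (-1) ^ (1 - (t : ℤ) / 2) else 1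

/-- The sign turns the determinant 2 of an odd cycle into -2, so that odd and even cycles share the
factor -2. -/
theorem neg_one_pow_mul_det_weightedCycleMatrix_one {t : ℕ} (ht : 0 < t) :
    (-1) ^ t * (weightedCycleMatrix t 1).det = -2 * cycleFactor t := by
  unfold cycleFactor
  rcases Nat.even_or_odd t with h | h
  · rw [det_weightedCycleMatrix_one_of_even h ht, if_pos h, h.neg_one_pow, one_mul]
  · rw [det_weightedCycleMatrix_one_of_odd h, if_neg (Nat.not_even_iff_odd.2 h), h.neg_one_pow]
    norm_num

open Classical in
/-- The determinant as a product over the mixed components. -/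
theorem det_integratedAdjMatrix_eq_prod_mixedComponent {V : Type*} [Fintype V] [DecidableEq V]
    (G : SimpleMixedGraph V) [Fintype G.MixedComponent]
    (hG : ∀ C : G.MixedComponent, C.graph.AP ∨ C.graph.AC) :
    G.integratedAdjMatrix.det =
      (∏ M : G.MixedComponent with M.graph.AP,
        (-1) ^ (M.graph.t + 1) * (weightedCycleMatrix (M.graph.t + 1) 0).det) *
      ∏ M : G.MixedComponent with M.graph.AC, (-2 * cycleFactor M.graph.t) := by
  obtain ⟨e, he⟩ := exists_equiv_connectedComponent G
  have := Fintype.ofEquiv _ e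
  have hAP : ∀ M : G.MixedComponent, M.graph.AP → (ofComponent (e M)).AP := fun M h => he M ▸ h
  have hAC : ∀ M : G.MixedComponent, M.graph.AC → (ofComponent (e M)).AC := fun M h => he M ▸ h
  -- The two properties exclude each other: the same component would have both t + 1 and t vertices.
  have hnot : ∀ M : G.MixedComponent, ¬ M.graph.AP ↔ M.graph.AC := by
    refine fun M => ⟨(hG M).resolve_left, fun h h' => ?_⟩
    have h1 := card_supp_of_AP (hAP M h')
    rw [card_supp_of_AC (hAC M h)] at h1
    omega
  -- The inserted signs multiply to (-1)^(2n) = 1.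
  have h1 : G.integratedAdjMatrix.det =
      ∏ M : G.MixedComponent, (-1) ^ Nat.card (e M).supp * componentDet (e M) := by
    rw [Finset.prod_mul_distrib, Finset.prod_pow_eq_pow_sum,
      e.sum_comp fun C => Nat.card C.supp, sum_card_supp, pow_mul, neg_one_sq, one_pow, one_mul,
      e.prod_comp fun C => componentDet C, det_integratedAdjMatrix_eq_prod]
  rw [h1, ← Finset.prod_filter_mul_prod_filter_not Finset.univ fun M => M.graph.AP]
  simp only [hnot]
  congr 1
  · refine Finset.prod_congr rfl fun M hM => ?_
    have hM := hAP M (Finset.mem_filter.1 hM).2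
    rw [card_supp_of_AP hM, componentDet_of_AP hM, he M]
  · refine Finset.prod_congr rfl fun M hM => ?_
    have hM := hAC M (Finset.mem_filter.1 hM).2
    rw [card_supp_of_AC hM, componentDet_of_AC hM, he M,
      neg_one_pow_mul_det_weightedCycleMatrix_one (by have := hM.exists_equiv.1; omega)]

end SimpleMixedGraph

theorem Finset.prod_filter_eq_prod_of_equiv {ι κ M : Type*} [Fintype ι] [Fintype κ] [CommMonoid M]
    {P : κ → Prop} [DecidablePred P] (e : ι ≃ {x // P x}) (f : κ → M) :
    ∏ x with P x, f x = ∏ i, f (e i).1 := by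
  rw [Finset.prod_subtype (p := P) _ (by simp), ← e.prod_comp]

theorem mainTheorem2 {V : Type*} [Fintype V] [DecidableEq V] (G : SimpleMixedGraph V)
    (hG : ∀ C : G.MixedComponent, C.graph.AP ∨ C.graph.AC)
    (q l : ℕ)
    (F : Fin q ≃ {C : G.MixedComponent // C.graph.AP})
    (H : Fin l ≃ {C : G.MixedComponent // C.graph.AC ∧ Even C.graph.t}) :
    ((∀ i, Odd (F i).1.graph.t) →
      G.integratedAdjMatrix.det =
        2 ^ G.numAC *
          (-1 : ℝ) ^ (2 * (Fintype.card V : ℤ) - (G.numAC : ℤ)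
            - ∑ i, ((F i).1.graph.t + 1 : ℤ) / 2) *
          ∑ S : Finset (Fin l),
            (-1 : ℝ) ^ ((S.card : ℤ) - ∑ i ∈ S, ((H i).1.graph.t : ℤ) / 2)) ∧
    ((¬ ∀ i, Odd (F i).1.graph.t) → G.integratedAdjMatrix.det = 0) := by
  classical
  have := Fintype.ofFinite G.MixedComponent
  have hone : (-1 : ℝ) ≠ 0 := by norm_num
  rw [G.det_integratedAdjMatrix_eq_prod_mixedComponent hG,
    Finset.prod_filter_eq_prod_of_equiv F]
  refine ⟨fun hodd => ?_, fun hodd => ?_⟩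
  · have hpaths : ∏ i, (-1) ^ ((F i).1.graph.t + 1) *
        (weightedCycleMatrix ((F i).1.graph.t + 1) 0).det =
        (-1 : ℝ) ^ (-∑ i, ((F i).1.graph.t + 1 : ℤ) / 2) := by
      rw [← Finset.sum_neg_distrib, ← Finset.prod_zpow_eq_zpow_sum hone]
      refine Finset.prod_congr rfl fun i _ => ?_
      rw [det_weightedCycleMatrix_zero_of_odd (hodd i), (hodd i).add_one.neg_one_pow, one_mul]
    have hcard : (Finset.univ.filter fun M : G.MixedComponent => M.graph.AC).card = G.numAC := by
      rw [SimpleMixedGraph.numAC, Nat.card_eq_fintype_card, Fintype.card_subtype]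
    have hcycles : ∏ M : G.MixedComponent with M.graph.AC,
        (-2 * SimpleMixedGraph.cycleFactor M.graph.t) = (-2 : ℝ) ^ G.numAC *
          ∑ S : Finset (Fin l),
            (-1 : ℝ) ^ ((S.card : ℤ) - ∑ i ∈ S, ((H i).1.graph.t : ℤ) / 2) := by
      rw [Finset.prod_mul_distrib, Finset.prod_const, hcard]
      unfold SimpleMixedGraph.cycleFactor
      -- Odd cycles have factor 1 and drop out; the product of 1 + x over the even ones expands over
      -- the subsets S.
      rw [← Finset.prod_filter, Finset.filter_filter, Finset.prod_filter_eq_prod_of_equiv H,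
        Finset.prod_one_add, Finset.powerset_univ]
      congr 1
      refine Finset.sum_congr rfl fun S _ => ?_
      rw [Finset.prod_zpow_eq_zpow_sum hone, Finset.sum_sub_distrib]
      simp
    -- The (-1)^(-p) of the stated formula is the sign in (-2)^p = (-1)^p 2^p.
    rw [hpaths, hcycles, sub_sub, zpow_sub₀ hone, zpow_mul, zpow_add₀ hone, zpow_neg,
      zpow_natCast, show ((-1 : ℝ) ^ (2 : ℤ)) = 1 by norm_num, one_pow, zpow_natCast,
      show (-2 : ℝ) = -1 * 2 by norm_num, mul_pow, one_div, mul_inv,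
      show ((-1 : ℝ) ^ G.numAC)⁻¹ = (-1) ^ G.numAC by
        rw [← inv_pow]; norm_num]
    ring
  · push Not at hodd
    obtain ⟨i, hi⟩ := hodd
    rw [Finset.prod_eq_zero (Finset.mem_univ i), zero_mul]
    rw [det_weightedCycleMatrix_zero_of_even (Nat.not_odd_iff_even.1 hi), mul_zero]
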